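/- **Conventions.** A category is *bicomplete* if it has all small limits and colimits. It is *coregular* if it has finite colimits, every morphism $f:A\to B$ has a regular image $\operatorname{im}(f)$ (the equaliser of its cokernel pair $B\rightrightarrows B\sqcup_f B$), and regular monomorphisms are stable under pushouts. In a closed symmetric monoidal category with internal hom $[-,-]$, an object $E$ is *dualising* if the canonical morphism $A\to[[A,E],E]$ is an isomorphism for every $A$; the category together with $E$ is then called *$*$-autonomous*. Let $\mathsf D$ be a closed symmetric monoidal category with pullbacks, with tensor unit $I$, and let $D\in\mathsf D$. The category $\mathsf{Chu}_D(\mathsf D)$ has as objects the triples $(A,A^\top,a)$ with $a:A\otimes A^\top\to D$; morphisms $(A,A^\top,a)\to(B,B^\top,b)$ are pairs $f:A\to B$, $f^\top:B^\top\to A^\top$ with $b\circ(f\otimes B^\top)=a\circ(A\otimes f^\top)$. Put $\mathcal I=(I,D,\lambda)$, $\mathcal D=(D,I,\rho)$ with $\lambda,\rho$ the unitors, $(A,A^\top,a)^*=(A^\top,A,a\circ\sigma)$ with $\sigma$ the braiding, $[\mathcal A,\mathcal B]=([A,B]\times_{[A\otimes B^\top,D]}[B^\top,A^\top],\,A\otimes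 B^\top,\,c)$ with the evident maps and pairing $c$, and $\mathcal A\otimes\mathcal B=[\mathcal A,\mathcal B^*]^*$, whose first component is $A\otimes B$. An object is *separated* if the transpose $A\to[A^\top,D]$ of $a$ is a regular monomorphism, and *extensional* if the transpose $A^\top\to[A,D]$ is one. When $\mathsf D$ is coregular, the *separation* $s\mathcal A$ is obtained by replacing $A$ by the regular image of $A\to[A^\top,D]$, and the *extensionalisation* $e\mathcal A$ by replacing $A^\top$ by the regular image of $A^\top\to[A,D]$. Finally, $\widehat{\mathsf{Chu}}_D(\mathsf D)\subseteq\mathsf{Chu}_D(\mathsf D)$ is the full subcategory of the objects that are both separated and extensional. **Theorem.** Let $\mathsf C$ be a cartesian closed category and $\mathsf D$ a closed symmetric monoidal category, both bicomplete and coregular, let $T\dashv|\cdot|$, $T:\mathsf C\to\mathsf D$, $|\cdot|:\mathsf D\to\mathsf C$, be an adjunction whose left adjoint $T$ is a strong symmetric monoidal functor (with respect to the cartesian product on $\mathsf C$), and let $D\in\mathsf D$ be an object. Then: 1. $\widehat{\mathsf{Chu}}_D(\mathsf D)$ is a $*$-autonomous category with tensor product $s(\mathcal A\otimes\mathcal B)$,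 tensor unit $s\mathcal I$, internal hom $e[\mathcal A,\mathcal B]$ and dualising object $e\mathcal D$. Here the symmetric monoidal structure is the one for which the canonical morphisms $A\otimes B\to\operatorname{im}(A\otimes B\to[(\mathcal A\otimes\mathcal B)^\top,D])$, where $(\mathcal A\otimes\mathcal B)^\top$ is the second component of $\mathcal A\otimes\mathcal B$, and $I\to\operatorname{im}(I\to[D,D])$ make the functor $\widehat{\mathsf{Chu}}_D(\mathsf D)\to\mathsf D$, $(A,A^\top,a)\mapsto A$, lax symmetric monoidal, and the evaluation of the internal hom is induced by the evaluation of $\mathsf D$. 2. The forgetful functor $$U:\widehat{\mathsf{Chu}}_D(\mathsf D)\to\mathsf C,\qquad (A,A^\top,a)\mapsto|A|,$$ has a left adjoint $M_D$ which is a strong symmetric monoidal functor from $\mathsf C$ with the cartesian product to $\widehat{\mathsf{Chu}}_D(\mathsf D)$ with the structure in 1. In other words, $M_D\dashv U$ is a symmetric monoidal adjunction between a cartesian closed category and a $*$-autonomous category. -/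

import Mathlib

open CategoryTheory MonoidalCategory Limits

universe v u v₁ u₁ v₂ u₂

noncomputable section

/-! ### Coregular categories and regular images -/

/-- A category is coregular if it has finite colimits, every morphism has a regular image (the
equalizer of its cokernel pair), and regular monomorphisms are stable under pushouts. -/
class Coregular (C : Type u) [Category.{v} C] : Prop extends HasFiniteColimits C where
  hasRegularImage : ∀ {X Y : C} (f : X ⟶ Y), HasEqualizer (pushout.inl f f) (pushout.inr f f)
  isStableUnderCobaseChange : (MorphismProperty.regularMono C).IsStableUnderCobaseChange

section RegularImage

variable {C : Type u} [Category.{v} C] [Coregular C] {X Y : C}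

instance Coregular.instHasRegularImage (f : X ⟶ Y) :
    HasEqualizer (pushout.inl f f) (pushout.inr f f) :=
  Coregular.hasRegularImage f

/-- The regular image of `f`: the equalizer of its cokernel pair. -/
abbrev regularImage (f : X ⟶ Y) : C := equalizer (pushout.inl f f) (pushout.inr f f)

/-- The inclusion of the regular image. -/
abbrev regularImage.ι (f : X ⟶ Y) : regularImage f ⟶ Y :=
  equalizer.ι (pushout.inl f f) (pushout.inr f f)

/-- The corestriction of `f` to its regular image. -/
abbrev regularImage.corestrict (f : X ⟶ Y) : X ⟶ regularImage f :=
  equalizer.lift f pushout.condition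

end RegularImage

/-! ### `*`-autonomous categories -/

section StarAutonomous

variable {C : Type u} [Category.{v} C] [MonoidalCategory C] [SymmetricCategory C]
  [MonoidalClosed C]

/-- The canonical morphism `A ⟶ [[A, D], D]`, the transpose of the evaluation. -/
def toDoubleDual (A D : C) : A ⟶ (ihom ((ihom A).obj D)).obj D :=
  MonoidalClosed.curry ((β_ ((ihom A).obj D) A).hom ≫ (ihom.ev A).app D)

/-- `D` is a dualising object, i.e. the closed symmetric monoidal category `C` together with `D`
is a `*`-autonomous category. -/
def IsDualizing (D : C) : Prop := ∀ A : C, IsIso (toDoubleDual A D)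

end StarAutonomous

/-! ### The Chu construction -/

/-- Objects of the Chu category: triples `(A, A', a : A ⊗ A' ⟶ D)`. -/
structure Chu {V : Type u} [Category.{v} V] [MonoidalCategory V] (D : V) where
  fst : V
  snd : V
  pair : fst ⊗ snd ⟶ D

namespace Chu

section Category

variable {V : Type u} [Category.{v} V] [MonoidalCategory V] {D : V}

/-- Morphisms `(A, A', a) ⟶ (B, B', b)`: pairs `f : A ⟶ B`, `f' : B' ⟶ A'` that are adjoint to
each other with respect to the pairings. -/
@[ext]
structure Hom (A B : Chu D) where
  fst : A.fst ⟶ B.fst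
  snd : B.snd ⟶ A.snd
  comm : fst ▷ B.snd ≫ B.pair = A.fst ◁ snd ≫ A.pair

instance : Category.{v} (Chu D) where
  Hom A B := Hom A B
  id A := ⟨𝟙 _, 𝟙 _, by simp⟩
  comp {A B E} f g := ⟨f.fst ≫ g.fst, g.snd ≫ f.snd, by
    rw [comp_whiskerRight, Category.assoc, g.comm, ← whisker_exchange_assoc, f.comm,
      MonoidalCategory.whiskerLeft_comp, Category.assoc]⟩

@[ext]
lemma hom_ext {A B : Chu D} {f g : A ⟶ B} (h₁ : f.fst = g.fst) (h₂ : f.snd = g.snd) : f = g :=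
  Hom.ext h₁ h₂

@[simp] lemma id_fst (A : Chu D) : Hom.fst (𝟙 A) = 𝟙 A.fst := rfl
@[simp] lemma id_snd (A : Chu D) : Hom.snd (𝟙 A) = 𝟙 A.snd := rfl
@[simp] lemma comp_fst {A B E : Chu D} (f : A ⟶ B) (g : B ⟶ E) :
    (f ≫ g).fst = f.fst ≫ g.fst := rfl
@[simp] lemma comp_snd {A B E : Chu D} (f : A ⟶ B) (g : B ⟶ E) :
    (f ≫ g).snd = g.snd ≫ f.snd := rfl

/-- The functor `(A, A', a) ↦ A`, `(f, f') ↦ f`. -/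
abbrev fstFunctor (D : V) : Chu D ⥤ V where
  obj A := A.fst
  map f := f.fst

/-- The dualising object `(D, I, ρ)`. -/
abbrev dualizing (D : V) : Chu D := ⟨D, 𝟙_ V, (ρ_ D).hom⟩

/-- The tensor unit `(I, D, λ)`. -/
abbrev unit (D : V) : Chu D := ⟨𝟙_ V, D, (λ_ D).hom⟩

end Category

section Closed

variable {V : Type u} [Category.{v} V] [MonoidalCategory V] [SymmetricCategory V] {D : V}

/-- The dual `(A', A, a ∘ σ)` of `(A, A', a)`. -/
abbrev dual (A : Chu D) : Chu D := ⟨A.snd, A.fst, (β_ A.snd A.fst).hom ≫ A.pair⟩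

variable [MonoidalClosed V]

/-- The transpose `A' ⟶ [A, D]` of the pairing. -/
def extMap (A : Chu D) : A.snd ⟶ (CategoryTheory.ihom A.fst).obj D :=
  MonoidalClosed.curry A.pair

/-- The transpose `A ⟶ [A', D]` of the pairing. -/
def sepMap (A : Chu D) : A.fst ⟶ (CategoryTheory.ihom A.snd).obj D :=
  MonoidalClosed.curry ((β_ A.snd A.fst).hom ≫ A.pair)

/-- The map `[A, B] ⟶ [A ⊗ B', D]` induced by evaluation and the pairing of `B`. -/
def homMapLeft (A B : Chu D) :
    (CategoryTheory.ihom A.fst).obj B.fst ⟶ (CategoryTheory.ihom (A.fst ⊗ B.snd)).obj D :=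
  MonoidalClosed.curry
    ((β_ (A.fst ⊗ B.snd) ((CategoryTheory.ihom A.fst).obj B.fst)).hom ≫
      (α_ ((CategoryTheory.ihom A.fst).obj B.fst) A.fst B.snd).inv ≫
      ((β_ ((CategoryTheory.ihom A.fst).obj B.fst) A.fst).hom ≫
        (ihom.ev A.fst).app B.fst) ▷ B.snd ≫ B.pair)

/-- The map `[B', A'] ⟶ [A ⊗ B', D]` induced by evaluation and the pairing of `A`. -/
def homMapRight (A B : Chu D) :
    (CategoryTheory.ihom B.snd).obj A.snd ⟶ (CategoryTheory.ihom (A.fst ⊗ B.snd)).obj D :=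
  MonoidalClosed.curry
    ((α_ A.fst B.snd ((CategoryTheory.ihom B.snd).obj A.snd)).hom ≫
      A.fst ◁ (ihom.ev B.snd).app A.snd ≫ A.pair)

section Pullbacks

variable [HasPullbacks V]

/-- The internal hom `([A, B]₀, A ⊗ B', c)` of the Chu category, where `[A, B]₀` is the pullback
of `[A, B] ⟶ [A ⊗ B', D] ⟵ [B', A']`. -/
abbrev internalHom (A B : Chu D) : Chu D where
  fst := pullback (homMapLeft A B) (homMapRight A B)
  snd := A.fst ⊗ B.snd
  pair := (β_ (pullback (homMapLeft A B) (homMapRight A B)) (A.fst ⊗ B.snd)).hom ≫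
    MonoidalClosed.uncurry (pullback.fst (homMapLeft A B) (homMapRight A B) ≫ homMapLeft A B)

/-- The projection `[A, B]₀ ⟶ [A, B]`. -/
abbrev internalHomProj (A B : Chu D) :
    (internalHom A B).fst ⟶ (CategoryTheory.ihom A.fst).obj B.fst :=
  pullback.fst (homMapLeft A B) (homMapRight A B)

/-- The tensor product of the Chu category, `A ⊗ B = [A, B^*]^*`; its underlying object is
`A.fst ⊗ B.fst`. -/
abbrev tensor (A B : Chu D) : Chu D := (internalHom A B.dual).dual

end Pullbacks

/-- `(A, A', a)` is extensional if `A' ⟶ [A, D]` is a regular monomorphism. -/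
def IsExtensional (A : Chu D) : Prop := IsRegularMono A.extMap

/-- `(A, A', a)` is separated if `A ⟶ [A', D]` is a regular monomorphism. -/
def IsSeparated (A : Chu D) : Prop := IsRegularMono A.sepMap

variable [Coregular V]

/-- The separation: replace `A` by the regular image of `A ⟶ [A', D]`. -/
abbrev separation (A : Chu D) : Chu D where
  fst := regularImage A.sepMap
  snd := A.snd
  pair := regularImage.ι A.sepMap ▷ A.snd ≫
    (β_ ((CategoryTheory.ihom A.snd).obj D) A.snd).hom ≫ (ihom.ev A.snd).app D

/-- The canonical map from `A` to its separation, on underlying objects. -/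
abbrev toSeparation (A : Chu D) : A.fst ⟶ A.separation.fst :=
  regularImage.corestrict A.sepMap

/-- The extensionalisation: replace `A'` by the regular image of `A' ⟶ [A, D]`. -/
abbrev extensionalisation (A : Chu D) : Chu D where
  fst := A.fst
  snd := regularImage A.extMap
  pair := A.fst ◁ regularImage.ι A.extMap ≫ (ihom.ev A.fst).app D

end Closed

end Chu

/-! ### The separated-extensional Chu category -/

section SepExtChu

variable {V : Type u} [Category.{v} V] [MonoidalCategory V] [SymmetricCategory V]
  [MonoidalClosed V]

/-- The full subcategory of the Chu category on the separated and extensional objects. -/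
abbrev SepExtChu (D : V) : Type max u v :=
  ObjectProperty.FullSubcategory (fun A : Chu D => A.IsSeparated ∧ A.IsExtensional)

/-- The forgetful functor `(A, A', a) ↦ A`. -/
abbrev SepExtChu.forget (D : V) : SepExtChu D ⥤ V :=
  ObjectProperty.ι (fun A : Chu D => A.IsSeparated ∧ A.IsExtensional) ⋙ Chu.fstFunctor D

/-- A closed symmetric monoidal structure on the separated-extensional Chu category, for which the
forgetful functor to `V` is lax symmetric monoidal, is *the* separated-extensional Chu structure
with dualising object `E` if

* the tensor product of `A` and `B` is the separation of their tensor product in the Chu category,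
  the laxity map `A.fst ⊗ B.fst ⟶ (A ⊗ B).fst` being the canonical map to the separation,
* the tensor unit is the separation of the tensor unit of the Chu category, likewise,
* the internal hom of `A` and `B` is the extensionalisation of their internal hom in the Chu
  category, the evaluation being induced by that of `V`,
* `E` is the extensionalisation of the dualising object of the Chu category.

The laxity maps are then epimorphisms and the forgetful functor is faithful, so that the
associator, the unitors, the braiding and the tensor product of morphisms are all determined by
those of `V`. -/
structure IsSepExtChuStructure [HasPullbacks V] [Coregular V] (D : V)
    [MonoidalCategory (SepExtChu D)] [SymmetricCategory (SepExtChu D)]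
    [MonoidalClosed (SepExtChu D)] [(SepExtChu.forget D).LaxBraided] (E : SepExtChu D) :
    Prop where
  tensor : ∀ A B : SepExtChu D, ∃ e : (A ⊗ B).obj ≅ (A.obj.tensor B.obj).separation,
    Functor.LaxMonoidal.μ (SepExtChu.forget D) A B ≫ e.hom.fst =
      (A.obj.tensor B.obj).toSeparation
  unit : ∃ e : (𝟙_ (SepExtChu D)).obj ≅ (Chu.unit D).separation,
    Functor.LaxMonoidal.ε (SepExtChu.forget D) ≫ e.hom.fst = (Chu.unit D).toSeparation
  internalHom : ∀ A B : SepExtChu D,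
    ∃ e : ((ihom A).obj B).obj ≅ (A.obj.internalHom B.obj).extensionalisation,
      e.hom.fst ≫ A.obj.internalHomProj B.obj =
        MonoidalClosed.curry
          (Functor.LaxMonoidal.μ (SepExtChu.forget D) A ((ihom A).obj B) ≫
            (SepExtChu.forget D).map ((ihom.ev A).app B))
  dualizing : E.obj = (Chu.dualizing D).extensionalisation

end SepExtChu

end

/-!
The proof describes a Chu space `A` by its *representable* forms `A.fst ⊗ X ⟶ D`, those obtained
from the pairing by a map `X ⟶ A.snd` (`Chu.IsRep`). A map `A.fst ⟶ B.fst` underlies a morphism of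
Chu spaces exactly if it pulls representable forms back to representable forms (`Chu.IsHom`). If `A`
is extensional, then the second component of that morphism is unique, so the forgetful functor from
separated extensional Chu spaces to `V` is faithful. A form on `A ⊗ B` is representable if and only
if it is so in each variable (`Chu.isRep_tensor_iff`); this reduces all statements about iterated
tensor products to coherence in `V`.

Coregularity enters through regular images. Corestrictions to regular images are epimorphisms
(`Coregular.epi_corestrict`), and hence strong monomorphisms are regular. Therefore a Chu space is
extensional if and only if its forms separate maps into `A.snd` and representability descends along
epimorphisms (`Chu.IsExtensional.isRep_of_epi`, `Chu.isExtensional_of_isRep`). The canonical map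
from `A` to its separation is a *quotient* (`Chu.IsQuotient`): an epimorphism that induces a
bijection on representable forms. Morphisms into separated objects factor uniquely through
quotients (`Chu.IsQuotient.exists_desc`), and quotients are stable under tensoring with extensional
objects, because `V` is closed and so tensoring preserves epimorphisms
(`Chu.IsQuotient.tensorRight`). Thus `s(s(A ⊗ B) ⊗ C)` and `s(A ⊗ s(B ⊗ C))` are separated
quotients of the same iterated tensor product and are identified, and likewise for the unitors and
the braiding. The laxity maps `A.fst ⊗ B.fst ⟶ s(A ⊗ B).fst` are epimorphisms and the forgetful
functor is faithful, so all axioms follow from those of `V` (`EpiInducingData`).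

The evaluation of `V` restricts to a universal one `A ⊗ e[A, B] ⟶ B`
(`SepExtChu.bijective_whiskerLeft_eval`), which gives the closed structure. The pairing of `A` is a
morphism `A ⊗ A^* ⟶ eD`, and by the description of the forms on a tensor product it exhibits `A^*`
as the internal hom from `A` to `eD`. Applied to `A^*`, the same statement identifies `A` with the
internal hom from `A^*` to `eD`, and `eD` is dualising (`SepExtChu.isDualizing_dualizingObj`).

Finally, every form is representable for the Chu space `(X, [X, D], ev)`, so its separation is the
free separated extensional Chu space on `X : V`. Both the free object on `X ⊗ Y` and the tensor
product of the free objects on `X` and `Y` are separated quotients of Chu spaces on `X ⊗ Y` for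
which every form is representable; hence the oplax structure on the free functor is invertible, and
`M_D` is its composite with the strong symmetric monoidal functor `T`.
-/

noncomputable section

/-! ### The (epi, regular mono) factorisation in a coregular category -/

namespace Coregular

variable {C : Type u} [Category.{v} C] [Coregular C] {X Y Z : C}

lemma mono_pushout_inl (f : X ⟶ Y) (m : X ⟶ Z) [IsRegularMono m] : Mono (pushout.inl f m) := by
  have := Coregular.isStableUnderCobaseChange (C := C)
  have : IsRegularMono (pushout.inl f m) :=
    MorphismProperty.of_isPushout (P := MorphismProperty.regularMono C)
      (IsPushout.of_hasPushout f m) ‹IsRegularMono m›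
  infer_instance

/-- With `e` the corestriction of `f` and `m` the inclusion of the regular image, the two
coprojections of the cokernel pair of `e` agree after composition with two consecutive pushouts
of `m`, which are monomorphisms. So they are equal, and `e` is an epimorphism. -/
instance epi_corestrict (f : X ⟶ Y) : Epi (regularImage.corestrict f) := by
  set e := regularImage.corestrict f
  set m := regularImage.ι f
  have hem : e ≫ m = f := equalizer.lift_ι _ _
  let a := pushout.inl (pushout.inr e e) m
  let c := pushout.inl (pushout.inl e e ≫ a) m
  let d₁ := pushout.inr (pushout.inl e e ≫ a) m
  let d₂ := pushout.inr (pushout.inr e e) m ≫ c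
  have : Mono a := mono_pushout_inl _ _
  have : Mono c := mono_pushout_inl _ _
  have h₁ : m ≫ d₁ = pushout.inl e e ≫ a ≫ c := by
    simpa using (pushout.condition (f := pushout.inl e e ≫ a) (g := m)).symm
  have h₂ : m ≫ d₂ = pushout.inr e e ≫ a ≫ c :=
    (pushout.condition_assoc (f := pushout.inr e e) (g := m) c).symm
  have hf : f ≫ d₁ = f ≫ d₂ := by
    have : (e ≫ m) ≫ d₁ = (e ≫ m) ≫ d₂ := by
      rw [Category.assoc, Category.assoc, h₁, h₂, pushout.condition_assoc]
    rwa [hem] at this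
  have hm : m ≫ d₁ = m ≫ d₂ := by
    have := equalizer.condition (pushout.inl f f) (pushout.inr f f) =≫ pushout.desc d₁ d₂ hf
    rwa [Category.assoc, Category.assoc, pushout.inl_desc, pushout.inr_desc] at this
  have hi : pushout.inl e e = pushout.inr e e := by
    rw [← cancel_mono a, ← cancel_mono c, Category.assoc, Category.assoc, ← h₁, ← h₂, hm]
  refine ⟨fun g h hgh => ?_⟩
  rw [← pushout.inl_desc g h hgh, hi, pushout.inr_desc]

/-- In a coregular category strong and regular monomorphisms coincide. Strong monomorphisms are
easier to handle, as they are left cancellable and are characterised by a lifting property. -/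
lemma isRegularMono_of_strongMono (f : X ⟶ Y) [StrongMono f] : IsRegularMono f := by
  have h : regularImage.corestrict f ≫ regularImage.ι f = f := equalizer.lift_ι _ _
  have : StrongMono (regularImage.corestrict f ≫ regularImage.ι f) := by rw [h]; infer_instance
  have : StrongMono (regularImage.corestrict f) := strongMono_of_strongMono _ (regularImage.ι f)
  have : IsIso (regularImage.corestrict f) := isIso_of_epi_of_strongMono _
  have : (MorphismProperty.regularMono C) (regularImage.corestrict f ≫ regularImage.ι f) :=
    (MorphismProperty.cancel_left_of_respectsIso _ _ _).2
      (inferInstanceAs (IsRegularMono (regularImage.ι f)))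
  rwa [h] at this

end Coregular

/-! ### Symmetric monoidal structures induced along a faithful functor -/

section EpiWhisker

variable {V : Type u} [Category.{v} V] [MonoidalCategory V] [SymmetricCategory V]
  [MonoidalClosed V] {X Y : V}

instance epi_whiskerLeft (W : V) (f : X ⟶ Y) [Epi f] : Epi (W ◁ f) :=
  inferInstanceAs (Epi ((tensorLeft W).map f))

instance epi_whiskerRight (W : V) (f : X ⟶ Y) [Epi f] : Epi (f ▷ W) := by
  have : f ▷ W = (β_ X W).hom ≫ W ◁ f ≫ (β_ W Y).hom := by simp
  rw [this]
  infer_instance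

end EpiWhisker

section Inducing

variable {E : Type u₁} [Category.{v₁} E] {V : Type u} [Category.{v} V] [MonoidalCategory V]

/-- Tensor product data on `E` that a functor `F : E ⥤ V` transports to those of the monoidal
category `V`, up to epimorphisms `ε : 𝟙 ⟶ F 𝟙` and `μ : F X ⊗ F Y ⟶ F (X ⊗ Y)`. This is the lax
counterpart of `Monoidal.InducingFunctorData`, where `ε` and `μ` are isomorphisms. -/
structure EpiInducingData [MonoidalCategoryStruct E] (F : E ⥤ V) where
  ε : 𝟙_ V ⟶ F.obj (𝟙_ E)
  μ (X Y : E) : F.obj X ⊗ F.obj Y ⟶ F.obj (X ⊗ Y)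
  epi_ε : Epi ε
  epi_μ (X Y : E) : Epi (μ X Y)
  μ_tensorHom {X Y X' Y' : E} (f : X ⟶ Y) (g : X' ⟶ Y') :
    μ X X' ≫ F.map (f ⊗ₘ g) = (F.map f ⊗ₘ F.map g) ≫ μ Y Y'
  μ_whiskerRight {X Y : E} (f : X ⟶ Y) (Z : E) :
    μ X Z ≫ F.map (f ▷ Z) = F.map f ▷ F.obj Z ≫ μ Y Z
  μ_whiskerLeft (Z : E) {X Y : E} (f : X ⟶ Y) :
    μ Z X ≫ F.map (Z ◁ f) = F.obj Z ◁ F.map f ≫ μ Z Y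
  μ_associator (X Y Z : E) :
    μ X Y ▷ F.obj Z ≫ μ (X ⊗ Y) Z ≫ F.map (α_ X Y Z).hom =
      (α_ (F.obj X) (F.obj Y) (F.obj Z)).hom ≫ F.obj X ◁ μ Y Z ≫ μ X (Y ⊗ Z)
  μ_leftUnitor (X : E) :
    ε ▷ F.obj X ≫ μ (𝟙_ E) X ≫ F.map (λ_ X).hom = (λ_ (F.obj X)).hom
  μ_rightUnitor (X : E) :
    F.obj X ◁ ε ≫ μ X (𝟙_ E) ≫ F.map (ρ_ X).hom = (ρ_ (F.obj X)).hom

namespace EpiInducingData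

section

variable [MonoidalCategoryStruct E] {F : E ⥤ V} (d : EpiInducingData F)

attribute [instance] epi_ε epi_μ
attribute [simp] μ_tensorHom μ_whiskerRight μ_whiskerLeft μ_associator μ_leftUnitor μ_rightUnitor

variable {X Y Z X' Y' : E} {W : V}

@[simp]
lemma μ_tensorHom_assoc (f : X ⟶ Y) (g : X' ⟶ Y') (h : F.obj (Y ⊗ Y') ⟶ W) :
    d.μ X X' ≫ F.map (f ⊗ₘ g) ≫ h = (F.map f ⊗ₘ F.map g) ≫ d.μ Y Y' ≫ h := by
  simpa only [Category.assoc] using d.μ_tensorHom f g =≫ h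

@[simp]
lemma μ_whiskerRight_assoc (f : X ⟶ Y) (h : F.obj (Y ⊗ Z) ⟶ W) :
    d.μ X Z ≫ F.map (f ▷ Z) ≫ h = F.map f ▷ F.obj Z ≫ d.μ Y Z ≫ h := by
  simpa only [Category.assoc] using d.μ_whiskerRight f Z =≫ h

@[simp]
lemma μ_whiskerLeft_assoc (f : X ⟶ Y) (h : F.obj (Z ⊗ Y) ⟶ W) :
    d.μ Z X ≫ F.map (Z ◁ f) ≫ h = F.obj Z ◁ F.map f ≫ d.μ Z Y ≫ h := by
  simpa only [Category.assoc] using d.μ_whiskerLeft Z f =≫ h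

@[simp]
lemma μ_associator_assoc (h : F.obj (X ⊗ Y ⊗ Z) ⟶ W) :
    d.μ X Y ▷ F.obj Z ≫ d.μ (X ⊗ Y) Z ≫ F.map (α_ X Y Z).hom ≫ h =
      (α_ (F.obj X) (F.obj Y) (F.obj Z)).hom ≫ F.obj X ◁ d.μ Y Z ≫ d.μ X (Y ⊗ Z) ≫ h := by
  simpa only [Category.assoc] using d.μ_associator X Y Z =≫ h

@[simp]
lemma μ_leftUnitor_assoc (h : F.obj X ⟶ W) :
    d.ε ▷ F.obj X ≫ d.μ (𝟙_ E) X ≫ F.map (λ_ X).hom ≫ h = (λ_ (F.obj X)).hom ≫ h := by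
  simpa only [Category.assoc] using d.μ_leftUnitor X =≫ h

@[simp]
lemma μ_rightUnitor_assoc (h : F.obj X ⟶ W) :
    F.obj X ◁ d.ε ≫ d.μ X (𝟙_ E) ≫ F.map (ρ_ X).hom ≫ h = (ρ_ (F.obj X)).hom ≫ h := by
  simpa only [Category.assoc] using d.μ_rightUnitor X =≫ h

lemma μ_associator_inv (X Y Z : E) :
    F.obj X ◁ d.μ Y Z ≫ d.μ X (Y ⊗ Z) ≫ F.map (α_ X Y Z).inv =
      (α_ (F.obj X) (F.obj Y) (F.obj Z)).inv ≫ d.μ X Y ▷ F.obj Z ≫ d.μ (X ⊗ Y) Z := by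
  rw [Iso.eq_inv_comp, ← d.μ_associator_assoc, ← F.map_comp, Iso.hom_inv_id, F.map_id,
    Category.comp_id]

lemma μ_associator_inv_assoc (h : F.obj ((X ⊗ Y) ⊗ Z) ⟶ W) :
    F.obj X ◁ d.μ Y Z ≫ d.μ X (Y ⊗ Z) ≫ F.map (α_ X Y Z).inv ≫ h =
      (α_ (F.obj X) (F.obj Y) (F.obj Z)).inv ≫ d.μ X Y ▷ F.obj Z ≫ d.μ (X ⊗ Y) Z ≫ h := by
  simpa only [Category.assoc] using d.μ_associator_inv X Y Z =≫ h

variable [SymmetricCategory V] [MonoidalClosed V]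

/-- The axioms of a monoidal category hold in `E`, as they may be checked after applying the
faithful functor `F` and precomposing with composites of the epimorphisms `μ` and `ε`, tensored
with objects. -/
abbrev monoidalCategory [F.Faithful] : MonoidalCategory E where
  tensorHom_def f g := F.map_injective <| by
    rw [← cancel_epi (d.μ _ _)]
    simp [MonoidalCategory.tensorHom_def]
  id_tensorHom_id X Y := F.map_injective <| by
    rw [← cancel_epi (d.μ _ _)]
    simp
  tensorHom_comp_tensorHom f₁ f₂ g₁ g₂ := F.map_injective <| by
    rw [← cancel_epi (d.μ _ _)]
    simp
  whiskerLeft_id X Y := F.map_injective <| by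
    rw [← cancel_epi (d.μ _ _)]
    simp
  id_whiskerRight X Y := F.map_injective <| by
    rw [← cancel_epi (d.μ _ _)]
    simp
  associator_naturality {X₁ X₂ X₃ Y₁ Y₂ Y₃} f₁ f₂ f₃ := F.map_injective <| by
    rw [← cancel_epi (d.μ _ _), ← cancel_epi (d.μ _ _ ▷ _)]
    simp only [Functor.map_comp, μ_associator_assoc, μ_tensorHom, μ_tensorHom_assoc,
      MonoidalCategory.whiskerRight_comp_tensorHom_assoc,
      MonoidalCategory.whiskerLeft_comp_tensorHom_assoc]
    rw [← MonoidalCategory.tensorHom_comp_whiskerRight_assoc,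
      ← MonoidalCategory.tensorHom_comp_whiskerLeft_assoc, μ_associator,
      MonoidalCategory.associator_naturality_assoc]
  leftUnitor_naturality f := F.map_injective <| by
    rw [← cancel_epi (d.μ _ _), ← cancel_epi (d.ε ▷ _)]
    simp only [Functor.map_comp, μ_whiskerLeft_assoc, ← whisker_exchange_assoc, μ_leftUnitor,
      μ_leftUnitor_assoc, leftUnitor_naturality]
  rightUnitor_naturality f := F.map_injective <| by
    rw [← cancel_epi (d.μ _ _), ← cancel_epi (_ ◁ d.ε)]
    simp only [Functor.map_comp, μ_whiskerRight_assoc, whisker_exchange_assoc, μ_rightUnitor,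
      μ_rightUnitor_assoc, rightUnitor_naturality]
  pentagon W X Y Z := F.map_injective <| by
    rw [← cancel_epi (d.μ _ _), ← cancel_epi (d.μ _ _ ▷ _), ← cancel_epi (d.μ _ _ ▷ _ ▷ _)]
    simp only [Functor.map_comp, μ_whiskerRight_assoc, μ_associator_assoc,
      ← MonoidalCategory.comp_whiskerRight_assoc, μ_associator]
    simp only [MonoidalCategory.comp_whiskerRight,
      Category.assoc, μ_associator_assoc, μ_whiskerLeft, whisker_assoc, Iso.inv_hom_id_assoc,
      associator_naturality_left_assoc, ← MonoidalCategory.whisker_exchange_assoc, μ_associator]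
    simp only [← MonoidalCategory.whiskerLeft_comp_assoc, μ_associator]
    simp
  triangle X Y := F.map_injective <| by
    rw [← cancel_epi (d.μ _ _), ← cancel_epi (d.μ _ _ ▷ _), ← cancel_epi ((_ ◁ d.ε) ▷ _)]
    simp only [Functor.map_comp, μ_whiskerRight, μ_associator_assoc, μ_whiskerLeft,
      ← MonoidalCategory.comp_whiskerRight_assoc, μ_rightUnitor]
    simp only [whisker_assoc, Category.assoc, Iso.inv_hom_id_assoc,
      ← MonoidalCategory.whiskerLeft_comp_assoc, μ_leftUnitor]
    simp

/-- A family of isomorphisms `X ⊗ Y ≅ Y ⊗ X` lying over the braiding of `V` is a symmetry. -/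
abbrev symmetricCategory [F.Faithful] (β : ∀ X Y : E, X ⊗ Y ≅ Y ⊗ X)
    (hβ : ∀ X Y, d.μ X Y ≫ F.map (β X Y).hom = (β_ (F.obj X) (F.obj Y)).hom ≫ d.μ Y X) :
    letI := d.monoidalCategory
    SymmetricCategory E :=
  letI := d.monoidalCategory
  { braiding := β
    braiding_naturality_right := fun X Y Z f => F.map_injective <| by
      rw [← cancel_epi (d.μ _ _)]
      simp [hβ, reassoc_of% hβ]
    braiding_naturality_left := fun f Z => F.map_injective <| by
      rw [← cancel_epi (d.μ _ _)]
      simp [hβ, reassoc_of% hβ]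
    hexagon_forward := fun X Y Z => F.map_injective <| by
      rw [← cancel_epi (d.μ _ _), ← cancel_epi (d.μ _ _ ▷ _)]
      simp only [Functor.map_comp, μ_associator_assoc, reassoc_of% hβ, μ_whiskerRight_assoc,
        BraidedCategory.braiding_naturality_right_assoc, μ_associator,
        ← MonoidalCategory.comp_whiskerRight_assoc, hβ]
      simp only [MonoidalCategory.comp_whiskerRight_assoc, μ_associator_assoc, μ_whiskerLeft]
      simp only [← MonoidalCategory.whiskerLeft_comp_assoc, hβ]
      simp
    hexagon_reverse := fun X Y Z => F.map_injective <| by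
      rw [← cancel_epi (d.μ _ _), ← cancel_epi (_ ◁ d.μ _ _)]
      simp only [Functor.map_comp, μ_associator_inv_assoc, reassoc_of% hβ, μ_whiskerLeft_assoc,
        BraidedCategory.braiding_naturality_left_assoc, μ_associator_inv,
        ← MonoidalCategory.whiskerLeft_comp_assoc, hβ]
      simp only [MonoidalCategory.whiskerLeft_comp_assoc, μ_associator_inv_assoc, μ_whiskerRight]
      simp only [← MonoidalCategory.comp_whiskerRight_assoc, hβ]
      simp
    symmetry := fun X Y => F.map_injective <| by
      rw [← cancel_epi (d.μ _ _)]
      simp [hβ, reassoc_of% hβ] }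

/-- The functor `F` is lax monoidal for the induced structure. -/
abbrev laxMonoidal [F.Faithful] :
    letI := d.monoidalCategory
    F.LaxMonoidal :=
  letI := d.monoidalCategory
  { ε := d.ε
    μ := d.μ
    μ_natural_left := fun f X => (d.μ_whiskerRight f X).symm
    μ_natural_right := fun X f => (d.μ_whiskerLeft X f).symm
    associativity := d.μ_associator
    left_unitality := fun X => (d.μ_leftUnitor X).symm
    right_unitality := fun X => (d.μ_rightUnitor X).symm }

end

end EpiInducingData

end Inducing

namespace Chu

/-! ### Representable forms -/

section Rep

variable {V : Type u} [Category.{v} V] [MonoidalCategory V] {D : V} {A B E : Chu D} {W X : V}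

/-- A form `p : A.fst ⊗ X ⟶ D` is representable for the Chu space `A` if it is obtained from the
pairing of `A` by substituting some `X ⟶ A.snd` in the second variable. -/
def IsRep (A : Chu D) {X : V} (p : A.fst ⊗ X ⟶ D) : Prop :=
  ∃ x : X ⟶ A.snd, A.fst ◁ x ≫ A.pair = p

lemma isRep_whiskerLeft (A : Chu D) (x : X ⟶ A.snd) : A.IsRep (A.fst ◁ x ≫ A.pair) := ⟨x, rfl⟩

lemma isRep_pair (A : Chu D) : A.IsRep A.pair := ⟨𝟙 _, by simp⟩

lemma IsRep.precomp {p : A.fst ⊗ X ⟶ D} (h : A.IsRep p) (g : W ⟶ X) :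
    A.IsRep (A.fst ◁ g ≫ p) := by
  obtain ⟨x, rfl⟩ := h
  exact ⟨g ≫ x, by simp⟩

lemma IsRep.of_eq_precomp {p : A.fst ⊗ X ⟶ D} (h : A.IsRep p) (g : W ⟶ X)
    {q : A.fst ⊗ W ⟶ D} (hq : q = A.fst ◁ g ≫ p) : A.IsRep q :=
  hq ▸ h.precomp g

lemma isRep_unit (p : 𝟙_ V ⊗ X ⟶ D) : (Chu.unit D).IsRep p :=
  ⟨(λ_ X).inv ≫ p, by simp⟩

/-- `f : A.fst ⟶ B.fst` is the first component of a morphism of Chu spaces `A ⟶ B`, that is, `f`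
pulls representable forms back to representable forms. -/
def IsHom (A B : Chu D) (f : A.fst ⟶ B.fst) : Prop := A.IsRep (f ▷ B.snd ≫ B.pair)

lemma Hom.isHom (f : A ⟶ B) : IsHom A B f.fst := ⟨f.snd, f.comm.symm⟩

lemma isHom_id (A : Chu D) : IsHom A A (𝟙 _) := Hom.isHom (𝟙 A)

lemma IsHom.isRep {f : A.fst ⟶ B.fst} (h : IsHom A B f) {p : B.fst ⊗ X ⟶ D} (hp : B.IsRep p) :
    A.IsRep (f ▷ X ≫ p) := by
  obtain ⟨x, rfl⟩ := hp
  exact IsRep.of_eq_precomp h x (by rw [whisker_exchange_assoc])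

lemma isHom_of_isRep {f : A.fst ⟶ B.fst}
    (h : ∀ {X : V} (p : B.fst ⊗ X ⟶ D), B.IsRep p → A.IsRep (f ▷ X ≫ p)) : IsHom A B f :=
  h _ B.isRep_pair

lemma IsHom.comp {f : A.fst ⟶ B.fst} {g : B.fst ⟶ E.fst} (hf : IsHom A B f) (hg : IsHom B E g) :
    IsHom A E (f ≫ g) := by
  have := hf.isRep hg
  rwa [← comp_whiskerRight_assoc] at this

/-- `u : A.fst ⟶ B.fst` is an epimorphism along which the representable forms of `A` are exactly
the pullbacks of the representable forms of `B`. The canonical map to the separation is the basic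
example. -/
structure IsQuotient (A B : Chu D) (u : A.fst ⟶ B.fst) : Prop where
  epi : Epi u
  isHom : IsHom A B u
  exists_extension {X : V} (p : A.fst ⊗ X ⟶ D) (hp : A.IsRep p) :
    ∃ p' : B.fst ⊗ X ⟶ D, B.IsRep p' ∧ u ▷ X ≫ p' = p

lemma IsQuotient.comp {u : A.fst ⟶ B.fst} {w : B.fst ⟶ E.fst} (hu : IsQuotient A B u)
    (hw : IsQuotient B E w) : IsQuotient A E (u ≫ w) where
  epi := have := hu.epi; have := hw.epi; epi_comp _ _
  isHom := hu.isHom.comp hw.isHom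
  exists_extension p hp := by
    obtain ⟨p', hp', rfl⟩ := hu.exists_extension p hp
    obtain ⟨p'', hp'', rfl⟩ := hw.exists_extension p' hp'
    exact ⟨p'', hp'', by simp⟩

lemma IsQuotient.of_iso (i : A.fst ≅ B.fst) (h : IsHom A B i.hom) (h' : IsHom B A i.inv) :
    IsQuotient A B i.hom where
  epi := inferInstance
  isHom := h
  exists_extension p hp := ⟨i.inv ▷ _ ≫ p, h'.isRep hp, by simp⟩

end Rep

section Extensional

variable {V : Type u} [Category.{v} V] [MonoidalCategory V] [MonoidalClosed V] {D : V}
  {A B E : Chu D} {W X : V}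

lemma uncurry_comp_extMap (A : Chu D) (x : X ⟶ A.snd) :
    MonoidalClosed.uncurry (x ≫ A.extMap) = A.fst ◁ x ≫ A.pair := by
  rw [MonoidalClosed.uncurry_natural_left, extMap, MonoidalClosed.uncurry_curry]

lemma IsExtensional.hom_ext (h : A.IsExtensional) {x y : X ⟶ A.snd}
    (hxy : A.fst ◁ x ≫ A.pair = A.fst ◁ y ≫ A.pair) : x = y := by
  have : IsRegularMono A.extMap := h
  rw [← uncurry_comp_extMap, ← uncurry_comp_extMap] at hxy
  exact (cancel_mono A.extMap).1 (MonoidalClosed.uncurry_injective hxy)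

/-- For an extensional Chu space, representability of a form descends along epimorphisms: the
transpose of the pairing is a regular monomorphism, so it lifts against epimorphisms. -/
lemma IsExtensional.isRep_of_epi (h : A.IsExtensional) (q : W ⟶ X) [Epi q] {p : A.fst ⊗ X ⟶ D}
    (hp : A.IsRep (A.fst ◁ q ≫ p)) : A.IsRep p := by
  have : IsRegularMono A.extMap := h
  obtain ⟨w, hw⟩ := hp
  have sq : CommSq w q A.extMap (MonoidalClosed.curry p) := ⟨by
    apply MonoidalClosed.uncurry_injective
    rw [uncurry_comp_extMap, hw, MonoidalClosed.uncurry_natural_left,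
      MonoidalClosed.uncurry_curry]⟩
  refine ⟨sq.lift, ?_⟩
  rw [← uncurry_comp_extMap, sq.fac_right, MonoidalClosed.uncurry_curry]

/-- Converse of `IsExtensional.hom_ext` and `IsExtensional.isRep_of_epi`: together these two
properties characterise the extensional Chu spaces. -/
lemma isExtensional_of_isRep [Coregular V]
    (hext : ∀ {X : V} (x y : X ⟶ A.snd), A.fst ◁ x ≫ A.pair = A.fst ◁ y ≫ A.pair → x = y)
    (hrep : ∀ {W X : V} (q : W ⟶ X) [Epi q] (p : A.fst ⊗ X ⟶ D),
      A.IsRep (A.fst ◁ q ≫ p) → A.IsRep p) : A.IsExtensional := by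
  have hm : Mono A.extMap := ⟨fun x y h => hext x y <| by
    rw [← uncurry_comp_extMap, ← uncurry_comp_extMap, h]⟩
  have : StrongMono A.extMap :=
    { mono := hm
      rlp := fun W X q _ => ⟨fun {f g} sq => by
        obtain ⟨x, hx⟩ := hrep q (MonoidalClosed.uncurry g)
          ⟨f, by rw [← uncurry_comp_extMap, sq.w, MonoidalClosed.uncurry_natural_left]⟩
        have hx' : x ≫ A.extMap = g := by
          apply MonoidalClosed.uncurry_injective
          rw [uncurry_comp_extMap, hx]
        exact ⟨⟨x, by rw [← cancel_mono A.extMap, Category.assoc, hx', sq.w], hx'⟩⟩⟩ }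
  exact Coregular.isRegularMono_of_strongMono _

variable [SymmetricCategory V]

lemma isSeparated_dual_iff (A : Chu D) : A.dual.IsSeparated ↔ A.IsExtensional := by
  simp [IsSeparated, IsExtensional, sepMap, extMap]

lemma isExtensional_dual_iff (A : Chu D) : A.dual.IsExtensional ↔ A.IsSeparated := Iff.rfl

lemma IsSeparated.hom_ext (h : B.IsSeparated) {f g : X ⟶ B.fst}
    (hfg : f ▷ B.snd ≫ B.pair = g ▷ B.snd ≫ B.pair) : f = g :=
  IsExtensional.hom_ext (A := B.dual) h <| by simpa using hfg

/-- Morphisms from `A` to a separated Chu space factor through every quotient of `A`. -/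
lemma IsQuotient.exists_desc {u : A.fst ⟶ B.fst} (hu : IsQuotient A B u) {g : A.fst ⟶ E.fst}
    (hg : IsHom A E g) (hE : E.IsSeparated) : ∃ h : B.fst ⟶ E.fst, IsHom B E h ∧ u ≫ h = g := by
  have := hu.epi
  obtain ⟨p, hp, hpg⟩ := hu.exists_extension _ hg
  obtain ⟨h, hh⟩ := IsExtensional.isRep_of_epi (A := E.dual) hE u
    (p := (β_ E.snd B.fst).hom ≫ p) ⟨g, by simp [hpg]⟩
  have hh' : h ▷ E.snd ≫ E.pair = p := by simpa using hh
  refine ⟨h, by rwa [IsHom, hh'], hE.hom_ext ?_⟩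
  rw [comp_whiskerRight_assoc, hh', hpg]

end Extensional

/-! ### Tensor products and internal homs of Chu spaces -/

section Tensor

variable {V : Type u} [Category.{v} V] [MonoidalCategory V] [SymmetricCategory V]

lemma homMapLeft_coherence (X Y Z : V) :
    (β_ (X ⊗ Y) Z).hom ≫ (α_ Z X Y).inv ≫ (β_ Z X).hom ▷ Y =
      (β_ X Y).hom ▷ Z ≫ (α_ Y X Z).hom ≫ (β_ Y (X ⊗ Z)).hom := by
  have h₁ : (β_ X Z).hom ▷ Y ≫ (β_ Z X).hom ▷ Y = 𝟙 _ := by simp [← comp_whiskerRight]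
  have h₂ : (β_ X Y).hom ▷ Z ≫ (β_ Y X).hom ▷ Z = 𝟙 _ := by simp [← comp_whiskerRight]
  simp [h₁, reassoc_of% h₂]

lemma braiding_coherence (X Y Z : V) :
    (β_ (X ⊗ Y) Z).hom ≫ (α_ Z X Y).inv ≫ (β_ Z X).hom ▷ Y =
      (α_ X Y Z).hom ≫ X ◁ (β_ Y Z).hom ≫ (α_ X Z Y).inv := by
  have h : (β_ X Z).hom ▷ Y ≫ (β_ Z X).hom ▷ Y = 𝟙 _ := by simp [← comp_whiskerRight]
  simp [h]

lemma associator_coherence (X Y Z : V) :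
    Z ◁ (β_ X Y).hom ≫ (α_ Z Y X).inv ≫ (β_ Z Y).hom ▷ X ≫ (β_ (Y ⊗ Z) X).hom =
      (β_ Z (X ⊗ Y)).hom ≫ (α_ X Y Z).hom := by
  have h₁ : (α_ Z Y X).inv ≫ (β_ Z Y).hom ▷ X ≫ (β_ (Y ⊗ Z) X).hom =
      (β_ Z (Y ⊗ X)).hom ≫ (β_ Y X).hom ▷ Z ≫ (α_ X Y Z).hom := by simp
  rw [h₁, BraidedCategory.braiding_naturality_right_assoc, ← comp_whiskerRight_assoc,
    SymmetricCategory.symmetry, id_whiskerRight, Category.id_comp]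

variable {D : V} {A B A' B' E : Chu D} {W X : V}

lemma isRep_dual_dual_iff (A : Chu D) (p : A.fst ⊗ X ⟶ D) : A.dual.dual.IsRep p ↔ A.IsRep p := by
  simp [IsRep]

variable [MonoidalClosed V]

omit [SymmetricCategory V] in
lemma uncurry_comp_homMapRight (y : X ⟶ (CategoryTheory.ihom B.snd).obj A.snd) :
    MonoidalClosed.uncurry (y ≫ homMapRight A B) =
      (α_ A.fst B.snd X).hom ≫ A.fst ◁ MonoidalClosed.uncurry y ≫ A.pair := by
  rw [MonoidalClosed.uncurry_natural_left, homMapRight, MonoidalClosed.uncurry_curry,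
    MonoidalClosed.uncurry_eq]
  simp

lemma uncurry_comp_homMapLeft (y : X ⟶ (CategoryTheory.ihom A.fst).obj B.fst) :
    MonoidalClosed.uncurry (y ≫ homMapLeft A B) =
      (β_ A.fst B.snd).hom ▷ X ≫ (α_ B.snd A.fst X).hom ≫
        B.snd ◁ MonoidalClosed.uncurry y ≫ (β_ B.snd B.fst).hom ≫ B.pair := by
  rw [MonoidalClosed.uncurry_natural_left, homMapLeft, MonoidalClosed.uncurry_curry,
    MonoidalClosed.uncurry_eq]
  have key := homMapLeft_coherence A.fst B.snd ((CategoryTheory.ihom A.fst).obj B.fst)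
  rw [comp_whiskerRight_assoc, reassoc_of% key, ← BraidedCategory.braiding_naturality_right_assoc,
    whisker_exchange_assoc, tensor_whiskerLeft_assoc]
  simp only [whiskerLeft_comp, Category.assoc, Iso.inv_hom_id_assoc]
  rfl

variable [HasPullbacks V]

lemma whiskerLeft_internalHom_dual_pair (x : X ⟶ (internalHom A B).fst) :
    (A.fst ⊗ B.snd) ◁ x ≫ (internalHom A B).dual.pair =
      MonoidalClosed.uncurry ((x ≫ internalHomProj A B) ≫ homMapLeft A B) := by
  have : (internalHom A B).dual.pair =
      MonoidalClosed.uncurry (internalHomProj A B ≫ homMapLeft A B) :=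
    SymmetricCategory.symmetry_assoc _ _ _
  rw [this, Category.assoc, MonoidalClosed.uncurry_natural_left x]

lemma whiskerLeft_internalHom_dual_pair' (x : X ⟶ (internalHom A B).fst) :
    (A.fst ⊗ B.snd) ◁ x ≫ (internalHom A B).dual.pair =
      MonoidalClosed.uncurry ((x ≫ pullback.snd _ _) ≫ homMapRight A B) := by
  rw [whiskerLeft_internalHom_dual_pair, Category.assoc, Category.assoc, pullback.condition]

/-- Representability for `[A, B]^*` can be tested in each of the two variables separately: this is
the universal property of the pullback defining `[A, B]`. -/
lemma isRep_internalHom_dual_iff (A B : Chu D) (p : (A.fst ⊗ B.snd) ⊗ X ⟶ D) :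
    (internalHom A B).dual.IsRep p ↔ A.IsRep ((α_ A.fst B.snd X).inv ≫ p) ∧
      B.dual.IsRep ((α_ B.snd A.fst X).inv ≫ (β_ B.snd A.fst).hom ▷ X ≫ p) := by
  constructor
  · rintro ⟨x, rfl⟩
    constructor
    · rw [whiskerLeft_internalHom_dual_pair', uncurry_comp_homMapRight, Iso.inv_hom_id_assoc]
      exact A.isRep_whiskerLeft _
    · rw [whiskerLeft_internalHom_dual_pair, uncurry_comp_homMapLeft,
        ← comp_whiskerRight_assoc, SymmetricCategory.symmetry, id_whiskerRight,
        Category.id_comp, Iso.inv_hom_id_assoc]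
      exact B.dual.isRep_whiskerLeft _
  · rintro ⟨⟨z, hz⟩, y, hy⟩
    have hz' : MonoidalClosed.uncurry (MonoidalClosed.curry z ≫ homMapRight A B) = p := by
      rw [uncurry_comp_homMapRight, MonoidalClosed.uncurry_curry, hz, Iso.hom_inv_id_assoc]
    have hy' : MonoidalClosed.uncurry (MonoidalClosed.curry y ≫ homMapLeft A B) = p := by
      rw [uncurry_comp_homMapLeft, MonoidalClosed.uncurry_curry, hy, Iso.hom_inv_id_assoc,
        ← comp_whiskerRight_assoc, SymmetricCategory.symmetry, id_whiskerRight, Category.id_comp]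
    -- Both transposes are sent to that of `p`, so they define a map to the pullback.
    refine ⟨pullback.lift (MonoidalClosed.curry y) (MonoidalClosed.curry z)
      (MonoidalClosed.uncurry_injective (hy'.trans hz'.symm)), ?_⟩
    rw [whiskerLeft_internalHom_dual_pair, pullback.lift_fst, hy']

lemma isExtensional_internalHom_dual [Coregular V] (hA : A.IsExtensional) (hB : B.IsSeparated) :
    (internalHom A B).dual.IsExtensional := by
  refine isExtensional_of_isRep (fun x y h => pullback.hom_ext ?_ ?_) (fun {W X} q _ p h => ?_)
  · rw [whiskerLeft_internalHom_dual_pair, whiskerLeft_internalHom_dual_pair,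
      uncurry_comp_homMapLeft, uncurry_comp_homMapLeft, cancel_epi, cancel_epi] at h
    exact MonoidalClosed.uncurry_injective (IsExtensional.hom_ext (A := B.dual) hB h)
  · rw [whiskerLeft_internalHom_dual_pair', whiskerLeft_internalHom_dual_pair',
      uncurry_comp_homMapRight, uncurry_comp_homMapRight, cancel_epi] at h
    exact MonoidalClosed.uncurry_injective (hA.hom_ext h)
  · rw [isRep_internalHom_dual_iff] at h ⊢
    refine ⟨hA.isRep_of_epi (B.snd ◁ q) ?_,
      IsExtensional.isRep_of_epi (A := B.dual) hB (A.fst ◁ q) ?_⟩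
    · simpa using h.1
    · have := h.2
      rw [← whisker_exchange_assoc] at this
      simpa using this

lemma mono_internalHomProj (hA : A.IsExtensional) (B : Chu D) : Mono (internalHomProj A B) := by
  have : Mono (homMapRight A B) := ⟨fun x y h => by
    have h' := congr(MonoidalClosed.uncurry $h)
    simp only [uncurry_comp_homMapRight, cancel_epi] at h'
    exact MonoidalClosed.uncurry_injective (hA.hom_ext h')⟩
  infer_instance

/-- A form on `A ⊗ B` is representable if and only if it is representable in each of the two
variables. The structure morphisms of the tensor product are obtained from this description. -/
lemma isRep_tensor_iff (A B : Chu D) (p : (A.fst ⊗ B.fst) ⊗ X ⟶ D) :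
    (A.tensor B).IsRep p ↔ A.IsRep ((α_ A.fst B.fst X).inv ≫ p) ∧
      B.IsRep ((α_ B.fst A.fst X).inv ≫ (β_ B.fst A.fst).hom ▷ X ≫ p) := by
  rw [← isRep_dual_dual_iff B]
  exact isRep_internalHom_dual_iff A B.dual p

lemma isExtensional_tensor [Coregular V] (hA : A.IsExtensional) (hB : B.IsExtensional) :
    (A.tensor B).IsExtensional :=
  isExtensional_internalHom_dual hA ((isSeparated_dual_iff B).2 hB)

lemma IsHom.tensor {f : A.fst ⟶ A'.fst} {g : B.fst ⟶ B'.fst} (hf : IsHom A A' f)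
    (hg : IsHom B B' g) : IsHom (A.tensor B) (A'.tensor B') (f ⊗ₘ g) := by
  refine isHom_of_isRep fun {X} p hp => ?_
  rw [isRep_tensor_iff] at hp ⊢
  constructor
  · have := (hf.isRep hp.1).precomp (g ▷ _)
    convert this using 1
    simp [tensorHom_def']
  · have := (hg.isRep hp.2).precomp (f ▷ _)
    convert this using 1
    have h := congr($(BraidedCategory.braiding_naturality g f) ▷ X ≫ p)
    simp only [comp_whiskerRight, Category.assoc] at h
    rw [← h]
    simp [tensorHom_def', -BraidedCategory.braiding_naturality]

lemma isHom_braiding (A B : Chu D) : IsHom (A.tensor B) (B.tensor A) (β_ A.fst B.fst).hom := by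
  refine isHom_of_isRep fun {X} p hp => ?_
  rw [isRep_tensor_iff] at hp ⊢
  exact ⟨hp.2, by simpa [← comp_whiskerRight_assoc] using hp.1⟩

lemma isHom_associator_hom (A B E : Chu D) :
    IsHom ((A.tensor B).tensor E) (A.tensor (B.tensor E)) (α_ A.fst B.fst E.fst).hom := by
  refine isHom_of_isRep fun {X} p hp => ?_
  simp only [isRep_tensor_iff] at hp ⊢
  obtain ⟨hA, hB, hE⟩ := hp
  refine ⟨⟨?_, ?_⟩, ?_⟩
  · exact hA.of_eq_precomp (α_ _ _ _).inv (by simp)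
  · refine hB.of_eq_precomp ((α_ _ _ _).inv ≫ (β_ _ _).hom ▷ _ ≫ (α_ _ _ _).hom) ?_
    have h : (β_ A.fst E.fst).hom ▷ X ≫ (β_ E.fst A.fst).hom ▷ X = 𝟙 _ := by
      simp [← comp_whiskerRight]
    have h' := congr(B.fst ◁ $h)
    rw [whiskerLeft_comp, whiskerLeft_id] at h'
    simp [reassoc_of% h']
  · refine hE.of_eq_precomp ((β_ _ _).hom ▷ _ ≫ (α_ _ _ _).hom) ?_
    rw [← comp_whiskerRight_assoc, ← associator_coherence]
    monoidal

lemma isHom_associator_inv (A B E : Chu D) :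
    IsHom (A.tensor (B.tensor E)) ((A.tensor B).tensor E) (α_ A.fst B.fst E.fst).inv := by
  refine isHom_of_isRep fun {X} p hp => ?_
  simp only [isRep_tensor_iff] at hp ⊢
  obtain ⟨⟨hA, hB⟩, hE⟩ := hp
  refine ⟨?_, ?_, ?_⟩
  · exact hA.of_eq_precomp (α_ _ _ _).hom (by simp)
  · refine hB.of_eq_precomp ((α_ _ _ _).inv ≫ (β_ _ _).hom ▷ _ ≫ (α_ _ _ _).hom) ?_
    simp
  · refine hE.of_eq_precomp ((α_ _ _ _).inv ≫ (β_ _ _).hom ▷ _) ?_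
    have h : (α_ E.fst B.fst A.fst).inv ≫ (β_ E.fst B.fst).hom ▷ A.fst ≫
        (β_ (B.fst ⊗ E.fst) A.fst).hom ≫ (α_ A.fst B.fst E.fst).inv =
        E.fst ◁ (β_ B.fst A.fst).hom ≫ (β_ E.fst (A.fst ⊗ B.fst)).hom := by
      rw [← cancel_mono (α_ A.fst B.fst E.fst).hom, Category.assoc, Category.assoc,
        Category.assoc, Category.assoc, Iso.inv_hom_id, ← associator_coherence,
        ← whiskerLeft_comp_assoc]
      simp
    have h' := congr($h ▷ X ≫ p)
    simp only [comp_whiskerRight, Category.assoc] at h'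
    calc
      _ = E.fst ◁ (α_ B.fst A.fst X).inv ≫ (α_ E.fst (B.fst ⊗ A.fst) X).inv ≫
          (α_ E.fst B.fst A.fst).inv ▷ X ≫ (β_ E.fst B.fst).hom ▷ A.fst ▷ X ≫
            (β_ (B.fst ⊗ E.fst) A.fst).hom ▷ X ≫ (α_ A.fst B.fst E.fst).inv ▷ X ≫ p := by
        monoidal
      _ = _ := by
        rw [h']
        monoidal

lemma isHom_leftUnitor_hom (A : Chu D) :
    IsHom ((Chu.unit D).tensor A) A (λ_ A.fst).hom := by
  refine isHom_of_isRep fun {X} p hp => ?_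
  rw [isRep_tensor_iff]
  exact ⟨isRep_unit _, hp.of_eq_precomp (λ_ _).hom (by simp)⟩

lemma isHom_leftUnitor_inv (A : Chu D) :
    IsHom A ((Chu.unit D).tensor A) (λ_ A.fst).inv := by
  refine isHom_of_isRep fun {X} p hp => ?_
  rw [isRep_tensor_iff] at hp
  exact hp.2.of_eq_precomp (λ_ _).inv (by simp)

lemma isHom_rightUnitor_hom (A : Chu D) :
    IsHom (A.tensor (Chu.unit D)) A (ρ_ A.fst).hom := by
  rw [← braiding_leftUnitor]
  exact (isHom_braiding A (Chu.unit D)).comp (isHom_leftUnitor_hom A)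

lemma isHom_rightUnitor_inv (A : Chu D) :
    IsHom A (A.tensor (Chu.unit D)) (ρ_ A.fst).inv := by
  have : (ρ_ A.fst).inv = (λ_ A.fst).inv ≫ (β_ _ _).hom := by simp
  rw [this]
  exact (isHom_leftUnitor_inv A).comp (isHom_braiding (Chu.unit D) A)

/-- Tensoring with an extensional Chu space preserves quotients. A form on `A ⊗ B` representable in
both variables extends to `A' ⊗ B` by the quotient property in the first variable, and the
extension is still representable in the second one by descent along the epimorphism `u ▷ X`. -/
lemma IsQuotient.tensorRight {u : A.fst ⟶ A'.fst} (hu : IsQuotient A A' u)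
    (hB : B.IsExtensional) : IsQuotient (A.tensor B) (A'.tensor B) (u ▷ B.fst) where
  epi := have := hu.epi; inferInstance
  isHom := by simpa using hu.isHom.tensor (isHom_id B)
  exists_extension {X} p hp := by
    have := hu.epi
    rw [isRep_tensor_iff] at hp
    obtain ⟨p', hp', hpp'⟩ := hu.exists_extension _ hp.1
    -- The extension `p'` of `p` along `u`, reassociated, pulls back to `p`.
    have key : u ▷ B.fst ▷ X ≫ (α_ _ _ _).hom ≫ p' = p := by
      rw [associator_naturality_left_assoc, hpp', Iso.hom_inv_id_assoc]
    refine ⟨(α_ _ _ _).hom ≫ p', (isRep_tensor_iff _ _ _).2 ⟨by simpa using hp', ?_⟩, key⟩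
    refine hB.isRep_of_epi (u ▷ X) ?_
    convert hp.2 using 1
    rw [← key]
    rw [← comp_whiskerRight_assoc, ← BraidedCategory.braiding_naturality_right]
    simp only [comp_whiskerRight, whisker_assoc, Category.assoc, Iso.inv_hom_id_assoc]

lemma IsQuotient.tensorLeft {u : A.fst ⟶ A'.fst} (hu : IsQuotient A A' u)
    (hB : B.IsExtensional) : IsQuotient (B.tensor A) (B.tensor A') (B.fst ◁ u) := by
  have h₁ := IsQuotient.of_iso (A := B.tensor A) (B := A.tensor B) (β_ _ _) (isHom_braiding B A)
    (by simpa [SymmetricCategory.braiding_swap_eq_inv_braiding] using isHom_braiding A B)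
  have h₂ := IsQuotient.of_iso (A := A'.tensor B) (B := B.tensor A') (β_ _ _) (isHom_braiding A' B)
    (by simpa [SymmetricCategory.braiding_swap_eq_inv_braiding] using isHom_braiding B A')
  simpa using (h₁.comp (hu.tensorRight hB)).comp h₂

end Tensor

/-! ### Separation and extensionalisation -/

section Separation

variable {V : Type u} [Category.{v} V] [MonoidalCategory V] [SymmetricCategory V]
  [MonoidalClosed V] [Coregular V] {D : V} {A B : Chu D} {W X : V}

lemma toSeparation_whiskerRight_pair (A : Chu D) :
    A.toSeparation ▷ A.snd ≫ A.separation.pair = A.pair := by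
  have : A.toSeparation ≫ regularImage.ι A.sepMap = A.sepMap := equalizer.lift_ι _ _
  rw [← comp_whiskerRight_assoc, this, BraidedCategory.braiding_naturality_left_assoc, sepMap,
    MonoidalClosed.whiskerLeft_curry_ihom_ev_app, SymmetricCategory.symmetry_assoc]

lemma isQuotient_toSeparation (A : Chu D) : IsQuotient A A.separation A.toSeparation where
  epi := inferInstance
  isHom := by
    rw [IsHom, toSeparation_whiskerRight_pair]
    exact A.isRep_pair
  exists_extension p hp := by
    obtain ⟨x, rfl⟩ := hp
    refine ⟨A.separation.fst ◁ x ≫ A.separation.pair, A.separation.isRep_whiskerLeft _, ?_⟩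
    rw [← whisker_exchange_assoc, toSeparation_whiskerRight_pair]

lemma isSeparated_separation (A : Chu D) : A.separation.IsSeparated := by
  have : A.separation.sepMap = regularImage.ι A.sepMap := by
    apply MonoidalClosed.uncurry_injective
    rw [sepMap, MonoidalClosed.uncurry_curry, MonoidalClosed.uncurry_eq]
    simp
  rw [IsSeparated, this]
  infer_instance

/-- The transpose of the pairing of `A` factors through that of its separation, so the latter is a
strong monomorphism if the former is. -/
lemma isExtensional_separation (hA : A.IsExtensional) : A.separation.IsExtensional := by
  have hm : A.separation.extMap ≫ (MonoidalClosed.pre A.toSeparation).app D = A.extMap := by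
    rw [extMap, MonoidalClosed.curry_pre_app, toSeparation_whiskerRight_pair, extMap]
  have : IsRegularMono A.extMap := hA
  have : StrongMono (A.separation.extMap ≫ (MonoidalClosed.pre A.toSeparation).app D) := by
    rw [hm]; infer_instance
  have : StrongMono A.separation.extMap :=
    strongMono_of_strongMono _ ((MonoidalClosed.pre A.toSeparation).app D)
  exact Coregular.isRegularMono_of_strongMono _

/-- The canonical map from the second component of `A` to that of its extensionalisation. -/
abbrev toExtensionalisation (A : Chu D) : A.snd ⟶ A.extensionalisation.snd :=
  regularImage.corestrict A.extMap

omit [SymmetricCategory V] in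
lemma whiskerLeft_toExtensionalisation_pair (A : Chu D) :
    A.extensionalisation.fst ◁ A.toExtensionalisation ≫ A.extensionalisation.pair = A.pair := by
  have : A.toExtensionalisation ≫ regularImage.ι A.extMap = A.extMap := equalizer.lift_ι _ _
  rw [← whiskerLeft_comp_assoc, this, extMap, MonoidalClosed.whiskerLeft_curry_ihom_ev_app]

omit [SymmetricCategory V] in
lemma isExtensional_extensionalisation (A : Chu D) : A.extensionalisation.IsExtensional := by
  have : A.extensionalisation.extMap = regularImage.ι A.extMap := by
    apply MonoidalClosed.uncurry_injective
    rw [extMap, MonoidalClosed.uncurry_curry, MonoidalClosed.uncurry_eq]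
  rw [IsExtensional, this]
  infer_instance

lemma isSeparated_extensionalisation (hA : A.IsSeparated) : A.extensionalisation.IsSeparated := by
  have hm : A.extensionalisation.sepMap ≫ (MonoidalClosed.pre A.toExtensionalisation).app D =
      A.sepMap := by
    rw [sepMap, MonoidalClosed.curry_pre_app, BraidedCategory.braiding_naturality_left_assoc,
      whiskerLeft_toExtensionalisation_pair, sepMap]
  have : IsRegularMono A.sepMap := hA
  have : StrongMono (A.extensionalisation.sepMap ≫
      (MonoidalClosed.pre A.toExtensionalisation).app D) := by
    rw [hm]; infer_instance
  have : StrongMono A.extensionalisation.sepMap :=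
    strongMono_of_strongMono _ ((MonoidalClosed.pre A.toExtensionalisation).app D)
  exact Coregular.isRegularMono_of_strongMono _

omit [SymmetricCategory V] in
/-- The extensionalisation is a coreflection: morphisms from an extensional Chu space to `A` are
also morphisms to the extensionalisation of `A`. -/
lemma IsExtensional.isHom_extensionalisation (hB : B.IsExtensional) {f : B.fst ⟶ A.fst}
    (hf : IsHom B A f) : IsHom B A.extensionalisation f := by
  refine hB.isRep_of_epi A.toExtensionalisation ?_
  rwa [whisker_exchange_assoc, whiskerLeft_toExtensionalisation_pair]

omit [SymmetricCategory V] in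
lemma isHom_extensionalisation_id (A : Chu D) : IsHom A.extensionalisation A (𝟙 A.fst) :=
  ⟨A.toExtensionalisation, by rw [whiskerLeft_toExtensionalisation_pair]; simp⟩

end Separation

/-! ### Evaluation and the dualising pairing -/

section Evaluation

variable {V : Type u} [Category.{v} V] [MonoidalCategory V] [SymmetricCategory V]
  [MonoidalClosed V] {D : V} {A B E : Chu D} {X : V}

lemma uncurry_comp_homMapLeft' (y : X ⟶ (CategoryTheory.ihom A.fst).obj B.fst) :
    MonoidalClosed.uncurry (y ≫ homMapLeft A B) =
      (β_ (A.fst ⊗ B.snd) X).hom ≫ (α_ X A.fst B.snd).inv ≫ (β_ X A.fst).hom ▷ B.snd ≫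
        MonoidalClosed.uncurry y ▷ B.snd ≫ B.pair := by
  have key := homMapLeft_coherence A.fst B.snd X
  rw [uncurry_comp_homMapLeft, reassoc_of% key, BraidedCategory.braiding_naturality_right_assoc]

variable [HasPullbacks V]

lemma whiskerRight_internalHom_pair (x : X ⟶ (internalHom A B).fst) :
    x ▷ (A.fst ⊗ B.snd) ≫ (internalHom A B).pair =
      (α_ X A.fst B.snd).inv ≫ (β_ X A.fst).hom ▷ B.snd ≫
        MonoidalClosed.uncurry (x ≫ internalHomProj A B) ▷ B.snd ≫ B.pair := by
  rw [BraidedCategory.braiding_naturality_left_assoc, ← MonoidalClosed.uncurry_natural_left,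
    ← Category.assoc, uncurry_comp_homMapLeft', SymmetricCategory.symmetry_assoc]

/-- The evaluation `A ⊗ [A, B] ⟶ B` of Chu spaces lies over the evaluation of `V`. -/
lemma isHom_uncurry_internalHomProj (A B : Chu D) :
    IsHom (A.tensor (internalHom A B)) B (MonoidalClosed.uncurry (internalHomProj A B)) := by
  rw [IsHom, isRep_tensor_iff]
  constructor
  · have h : MonoidalClosed.uncurry (internalHomProj A B ≫ homMapLeft A B) =
        MonoidalClosed.uncurry (pullback.snd _ _ ≫ homMapRight A B) := by rw [pullback.condition]
    rw [uncurry_comp_homMapRight, uncurry_comp_homMapLeft',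
      reassoc_of% braiding_coherence A.fst B.snd (internalHom A B).fst, cancel_epi] at h
    refine (A.isRep_whiskerLeft (MonoidalClosed.uncurry (pullback.snd _ _))).of_eq_precomp
      (β_ _ _).hom ?_
    rw [← h, ← whiskerLeft_comp_assoc, SymmetricCategory.symmetry, whiskerLeft_id,
      Category.id_comp]
  · have h := whiskerRight_internalHom_pair (A := A) (B := B) (𝟙 _)
    rw [Category.id_comp] at h
    rw [← h]
    exact (internalHom A B).isRep_pair.of_eq_precomp (𝟙 _) (by simp)

/-- The transpose of a morphism `A ⊗ E ⟶ B` of Chu spaces lies over the transpose in `V`. -/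
lemma IsHom.exists_internalHom_lift {g : A.fst ⊗ E.fst ⟶ B.fst} (hg : IsHom (A.tensor E) B g) :
    ∃ x : E.fst ⟶ (internalHom A B).fst,
      x ≫ internalHomProj A B = MonoidalClosed.curry g ∧ IsHom E (internalHom A B) x := by
  obtain ⟨⟨w, hw⟩, hE⟩ := (isRep_tensor_iff _ _ _).1 hg
  have h : MonoidalClosed.curry g ≫ homMapLeft A B =
      MonoidalClosed.curry ((β_ B.snd E.fst).hom ≫ w) ≫ homMapRight A B := by
    apply MonoidalClosed.uncurry_injective
    rw [uncurry_comp_homMapRight, uncurry_comp_homMapLeft', MonoidalClosed.uncurry_curry,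
      MonoidalClosed.uncurry_curry, whiskerLeft_comp_assoc, hw,
      reassoc_of% braiding_coherence A.fst B.snd E.fst]
  refine ⟨pullback.lift _ _ h, pullback.lift_fst _ _ _, ?_⟩
  rwa [IsHom, whiskerRight_internalHom_pair, pullback.lift_fst, MonoidalClosed.uncurry_curry]

lemma isHom_dualizing_iff (g : A.fst ⊗ B.fst ⟶ D) :
    IsHom (A.tensor B) (Chu.dualizing D) g ↔ A.IsRep g ∧ B.IsRep ((β_ B.fst A.fst).hom ≫ g) := by
  have h₁ : (α_ A.fst B.fst (𝟙_ V)).inv ≫ g ▷ 𝟙_ V ≫ (ρ_ D).hom = A.fst ◁ (ρ_ B.fst).hom ≫ g := by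
    simp
  have h₂ : (α_ B.fst A.fst (𝟙_ V)).inv ≫ (β_ B.fst A.fst).hom ▷ 𝟙_ V ≫ g ▷ 𝟙_ V ≫ (ρ_ D).hom =
      B.fst ◁ (ρ_ A.fst).hom ≫ (β_ B.fst A.fst).hom ≫ g := by
    simp
  rw [IsHom, isRep_tensor_iff]
  constructor
  · rintro ⟨hA, hB⟩
    exact ⟨hA.of_eq_precomp (ρ_ _).inv (by rw [h₁]; simp),
      hB.of_eq_precomp (ρ_ _).inv (by rw [h₂]; simp)⟩
  · rintro ⟨hA, hB⟩
    exact ⟨hA.of_eq_precomp _ h₁, hB.of_eq_precomp _ h₂⟩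

end Evaluation

section UnitFree

variable {V : Type u} [Category.{v} V] [MonoidalCategory V] [SymmetricCategory V]
  [MonoidalClosed V] [Coregular V] (D : V)

omit [SymmetricCategory V] in
lemma isExtensional_unit : (Chu.unit D).IsExtensional :=
  isExtensional_of_isRep (fun x y h => by simpa using h) (fun _ _ p _ => isRep_unit p)

lemma isSeparated_dualizing : (Chu.dualizing D).IsSeparated := by
  have h : (Chu.dualizing D).dual = Chu.unit D := by simp
  rw [← isExtensional_dual_iff, h]
  exact isExtensional_unit D

/-- The free Chu space `(X, [X, D], ev)` on `X`: every form on `X` is representable, so every map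
`X ⟶ B.fst` is a morphism of Chu spaces. -/
abbrev free (X : V) : Chu D := ⟨X, (CategoryTheory.ihom X).obj D, (ihom.ev X).app D⟩

variable {D}

omit [SymmetricCategory V] [Coregular V] in
lemma isRep_free {X Y : V} (p : X ⊗ Y ⟶ D) : (free D X).IsRep p :=
  ⟨MonoidalClosed.curry p, MonoidalClosed.whiskerLeft_curry_ihom_ev_app _ _ _⟩

omit [SymmetricCategory V] in
variable (D) in
lemma isExtensional_free (X : V) : (free D X).IsExtensional :=
  isExtensional_of_isRep (fun _ _ h => MonoidalClosed.uncurry_injective h)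
    (fun _ _ p _ => isRep_free p)

omit [SymmetricCategory V] [Coregular V] in
lemma isHom_free {X : V} {B : Chu D} (f : X ⟶ B.fst) : IsHom (free D X) B f := isRep_free _

end UnitFree

end Chu

/-! ### Dualising objects -/

section Dualizing

variable {C : Type u} [Category.{v} C] [MonoidalCategory C] [MonoidalClosed C]

/-- A pairing `π : A ⊗ B ⟶ Z` with the universal property of an evaluation identifies `B` with `[A,
Z]`. -/
lemma isIso_curry_of_bijective {A B Z : C} (π : A ⊗ B ⟶ Z)
    (h : ∀ X : C, Function.Bijective fun k : X ⟶ B => A ◁ k ≫ π) :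
    IsIso (MonoidalClosed.curry π) := by
  obtain ⟨k, hk⟩ := (h _).2 ((ihom.ev A).app Z)
  dsimp only at hk
  refine ⟨k, (h _).1 ?_, ?_⟩
  · dsimp only
    rw [whiskerLeft_comp, Category.assoc, hk, MonoidalClosed.whiskerLeft_curry_ihom_ev_app,
      whiskerLeft_id, Category.id_comp]
  · rw [← MonoidalClosed.curry_natural_left, hk, ← MonoidalClosed.uncurry_id_eq_ev,
      MonoidalClosed.curry_uncurry]

variable [SymmetricCategory C]

/-- If `π : A ⊗ B ⟶ Z` identifies `B` with `[A, Z]` and `A` with `[B, Z]`, then `A` is isomorphic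
to its double dual with respect to `Z`, through the canonical morphism. -/
lemma isIso_toDoubleDual {A B Z : C} (π : A ⊗ B ⟶ Z) [IsIso (MonoidalClosed.curry π)]
    [IsIso (MonoidalClosed.curry ((β_ B A).hom ≫ π))] : IsIso (toDoubleDual A Z) := by
  have h : toDoubleDual A Z ≫ (MonoidalClosed.pre (MonoidalClosed.curry π)).app Z =
      MonoidalClosed.curry ((β_ B A).hom ≫ π) := by
    rw [toDoubleDual, MonoidalClosed.curry_pre_app, BraidedCategory.braiding_naturality_left_assoc,
      MonoidalClosed.whiskerLeft_curry_ihom_ev_app]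
  have : IsIso ((MonoidalClosed.pre (MonoidalClosed.curry π)).app Z) :=
    inferInstanceAs (IsIso ((MonoidalClosed.internalHom.map (MonoidalClosed.curry π).op).app Z))
  have : IsIso (toDoubleDual A Z ≫ (MonoidalClosed.pre (MonoidalClosed.curry π)).app Z) := by
    rw [h]; infer_instance
  exact IsIso.of_isIso_comp_right _ ((MonoidalClosed.pre (MonoidalClosed.curry π)).app Z)

end Dualizing

namespace SepExtChu

variable {V : Type u} [Category.{v} V] [MonoidalCategory V] [SymmetricCategory V]
  [MonoidalClosed V] {D : V}

/-! ### Morphisms of separated extensional Chu spaces -/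

/-- A morphism of separated extensional Chu spaces from its first component. -/
def homMk {A B : SepExtChu D} (f : A.obj.fst ⟶ B.obj.fst) (h : Chu.IsHom A.obj B.obj f) : A ⟶ B :=
  ObjectProperty.homMk ⟨f, h.choose, h.choose_spec.symm⟩

lemma isHom_forget_map {A B : SepExtChu D} (f : A ⟶ B) :
    Chu.IsHom A.obj B.obj ((forget D).map f) := f.hom.isHom

/-- The second component of a morphism is determined by the first one, as the source is
extensional. -/
instance : (forget D).Faithful where
  map_injective {A B} f g h := by
    refine ObjectProperty.hom_ext _ (Chu.hom_ext h (A.property.2.hom_ext ?_))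
    rw [← f.hom.comm, ← g.hom.comm]
    exact congr($h ▷ _ ≫ _)

section Desc

variable {A : Chu D} {B E : SepExtChu D} {u : A.fst ⟶ B.obj.fst}

/-- The factorisation of `g` through a quotient `u` of `A`, as a morphism of separated extensional
Chu spaces. -/
def desc (hu : Chu.IsQuotient A B.obj u) (g : A.fst ⟶ E.obj.fst) (hg : Chu.IsHom A E.obj g) :
    B ⟶ E :=
  homMk _ (hu.exists_desc hg E.property.1).choose_spec.1

lemma fac_desc (hu : Chu.IsQuotient A B.obj u) (g : A.fst ⟶ E.obj.fst)
    (hg : Chu.IsHom A E.obj g) : u ≫ (forget D).map (desc hu g hg) = g :=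
  (hu.exists_desc hg E.property.1).choose_spec.2

lemma hom_ext_of_isQuotient (hu : Chu.IsQuotient A B.obj u) {f g : B ⟶ E}
    (h : u ≫ (forget D).map f = u ≫ (forget D).map g) : f = g := by
  have := hu.epi
  exact (forget D).map_injective ((cancel_epi u).1 h)

variable {A' : Chu D} {B' : SepExtChu D} {u' : A'.fst ⟶ B'.obj.fst}

/-- Separated quotients of isomorphic Chu spaces are isomorphic. -/
def isoOfQuotient (hu : Chu.IsQuotient A B.obj u) (hu' : Chu.IsQuotient A' B'.obj u')
    (i : A.fst ≅ A'.fst) (h : Chu.IsHom A A' i.hom) (h' : Chu.IsHom A' A i.inv) : B ≅ B' where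
  hom := desc hu (i.hom ≫ u') (h.comp hu'.isHom)
  inv := desc hu' (i.inv ≫ u) (h'.comp hu.isHom)
  hom_inv_id := hom_ext_of_isQuotient hu (by
    rw [Functor.map_comp, ← Category.assoc, fac_desc, Category.assoc, fac_desc]; simp)
  inv_hom_id := hom_ext_of_isQuotient hu' (by
    rw [Functor.map_comp, ← Category.assoc, fac_desc, Category.assoc, fac_desc]; simp)

lemma fac_isoOfQuotient_hom (hu : Chu.IsQuotient A B.obj u) (hu' : Chu.IsQuotient A' B'.obj u')
    (i : A.fst ≅ A'.fst) (h : Chu.IsHom A A' i.hom) (h' : Chu.IsHom A' A i.inv) :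
    u ≫ (forget D).map (isoOfQuotient hu hu' i h h').hom = i.hom ≫ u' :=
  fac_desc hu (i.hom ≫ u') (h.comp hu'.isHom)

end Desc

/-! ### The symmetric monoidal structure -/

section Monoidal

variable [HasPullbacks V] [Coregular V]

/-- The tensor product `s(A ⊗ B)`. -/
def tensorObj (A B : SepExtChu D) : SepExtChu D :=
  ⟨(A.obj.tensor B.obj).separation, Chu.isSeparated_separation _,
    Chu.isExtensional_separation (Chu.isExtensional_tensor A.property.2 B.property.2)⟩

variable (D) in
/-- The tensor unit `sI`. -/
def tensorUnit : SepExtChu D :=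
  ⟨(Chu.unit D).separation, Chu.isSeparated_separation _,
    Chu.isExtensional_separation (Chu.isExtensional_unit D)⟩

/-- The laxity map of the forgetful functor. -/
def μ (A B : SepExtChu D) : A.obj.fst ⊗ B.obj.fst ⟶ (tensorObj A B).obj.fst :=
  (A.obj.tensor B.obj).toSeparation

variable (D) in
/-- The unit map of the forgetful functor. -/
def ε : 𝟙_ V ⟶ (tensorUnit D).obj.fst := (Chu.unit D).toSeparation

lemma isQuotient_μ (A B : SepExtChu D) :
    Chu.IsQuotient (A.obj.tensor B.obj) (tensorObj A B).obj (μ A B) :=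
  Chu.isQuotient_toSeparation _

omit [HasPullbacks V] in
variable (D) in
lemma isQuotient_ε : Chu.IsQuotient (Chu.unit D) (tensorUnit D).obj (ε D) :=
  Chu.isQuotient_toSeparation _

lemma isQuotient_μ_left (A B E : SepExtChu D) :
    Chu.IsQuotient ((A.obj.tensor B.obj).tensor E.obj) (tensorObj (tensorObj A B) E).obj
      (μ A B ▷ E.obj.fst ≫ μ (tensorObj A B) E) :=
  ((isQuotient_μ A B).tensorRight E.property.2).comp (isQuotient_μ _ _)

lemma isQuotient_μ_right (A B E : SepExtChu D) :
    Chu.IsQuotient (A.obj.tensor (B.obj.tensor E.obj)) (tensorObj A (tensorObj B E)).obj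
      (A.obj.fst ◁ μ B E ≫ μ A (tensorObj B E)) :=
  ((isQuotient_μ B E).tensorLeft A.property.2).comp (isQuotient_μ _ _)

lemma isQuotient_leftUnit (A : SepExtChu D) :
    Chu.IsQuotient ((Chu.unit D).tensor A.obj) (tensorObj (tensorUnit D) A).obj
      (ε D ▷ A.obj.fst ≫ μ (tensorUnit D) A) :=
  ((isQuotient_ε D).tensorRight A.property.2).comp (isQuotient_μ _ _)

lemma isQuotient_rightUnit (A : SepExtChu D) :
    Chu.IsQuotient (A.obj.tensor (Chu.unit D)) (tensorObj A (tensorUnit D)).obj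
      (A.obj.fst ◁ ε D ≫ μ A (tensorUnit D)) :=
  ((isQuotient_ε D).tensorLeft A.property.2).comp (isQuotient_μ _ _)

section Hom

variable {A A' B B' : SepExtChu D}

lemma isHom_tensorHom_μ (f : A ⟶ A') (g : B ⟶ B') :
    Chu.IsHom (A.obj.tensor B.obj) (tensorObj A' B').obj
      (((forget D).map f ⊗ₘ (forget D).map g) ≫ μ A' B') :=
  ((isHom_forget_map f).tensor (isHom_forget_map g)).comp (isQuotient_μ A' B').isHom

lemma isHom_whiskerLeft_μ (A : SepExtChu D) (g : B ⟶ B') :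
    Chu.IsHom (A.obj.tensor B.obj) (tensorObj A B').obj
      (A.obj.fst ◁ (forget D).map g ≫ μ A B') :=
  Chu.IsHom.comp (by simpa using (Chu.isHom_id A.obj).tensor (isHom_forget_map g))
    (isQuotient_μ A B').isHom

lemma isHom_whiskerRight_μ (f : A ⟶ A') (B : SepExtChu D) :
    Chu.IsHom (A.obj.tensor B.obj) (tensorObj A' B).obj
      ((forget D).map f ▷ B.obj.fst ≫ μ A' B) :=
  Chu.IsHom.comp (by simpa using (isHom_forget_map f).tensor (Chu.isHom_id B.obj))
    (isQuotient_μ A' B).isHom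

end Hom

omit [HasPullbacks V] [Coregular V] in
lemma isQuotient_id (A : SepExtChu D) : Chu.IsQuotient A.obj A.obj (𝟙 A.obj.fst) :=
  Chu.IsQuotient.of_iso (Iso.refl _) (Chu.isHom_id _) (Chu.isHom_id _)

/-- The structure morphisms are those of `V`, transported along the quotient maps from iterated
tensor products of Chu spaces. -/
abbrev monoidalCategoryStruct : MonoidalCategoryStruct (SepExtChu D) where
  tensorObj := tensorObj
  tensorUnit := tensorUnit D
  tensorHom f g := desc (isQuotient_μ _ _) _ (isHom_tensorHom_μ f g)
  whiskerLeft A _ _ g := desc (isQuotient_μ _ _) _ (isHom_whiskerLeft_μ A g)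
  whiskerRight f B := desc (isQuotient_μ _ _) _ (isHom_whiskerRight_μ f B)
  associator A B E := isoOfQuotient (isQuotient_μ_left A B E) (isQuotient_μ_right A B E) (α_ _ _ _)
    (Chu.isHom_associator_hom _ _ _) (Chu.isHom_associator_inv _ _ _)
  leftUnitor A := isoOfQuotient (isQuotient_leftUnit A) (isQuotient_id A) (λ_ _)
    (Chu.isHom_leftUnitor_hom _) (Chu.isHom_leftUnitor_inv _)
  rightUnitor A := isoOfQuotient (isQuotient_rightUnit A) (isQuotient_id A) (ρ_ _)
    (Chu.isHom_rightUnitor_hom _) (Chu.isHom_rightUnitor_inv _)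

attribute [local instance] monoidalCategoryStruct in
variable (D) in
def inducingData : EpiInducingData (forget D) where
  ε := ε D
  μ := μ
  epi_ε := (isQuotient_ε D).epi
  epi_μ A B := (isQuotient_μ A B).epi
  μ_tensorHom {A _ A' _} f g := fac_desc (isQuotient_μ A A') _ (isHom_tensorHom_μ f g)
  μ_whiskerRight {A _} f B := fac_desc (isQuotient_μ A B) _ (isHom_whiskerRight_μ f B)
  μ_whiskerLeft A B _ f := fac_desc (isQuotient_μ A B) _ (isHom_whiskerLeft_μ A f)
  μ_associator A B E := by
    rw [← Category.assoc]
    exact fac_isoOfQuotient_hom (isQuotient_μ_left A B E) (isQuotient_μ_right A B E) _ _ _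
  μ_leftUnitor A := by
    rw [← Category.assoc]
    exact (fac_isoOfQuotient_hom (isQuotient_leftUnit A) (isQuotient_id A) _ _ _).trans
      (Category.comp_id _)
  μ_rightUnitor A := by
    rw [← Category.assoc]
    exact (fac_isoOfQuotient_hom (isQuotient_rightUnit A) (isQuotient_id A) _ _ _).trans
      (Category.comp_id _)

attribute [local instance] monoidalCategoryStruct in
/-- The monoidal structure with tensor product `s(A ⊗ B)` and unit `sI`. -/
abbrev monoidalCategory : MonoidalCategory (SepExtChu D) := (inducingData D).monoidalCategory

attribute [local instance] monoidalCategory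

/-- The braiding, induced by that of `V`. -/
def braiding (A B : SepExtChu D) : A ⊗ B ≅ B ⊗ A :=
  isoOfQuotient (isQuotient_μ A B) (isQuotient_μ B A) (β_ _ _) (Chu.isHom_braiding _ _)
    (by simpa [SymmetricCategory.braiding_swap_eq_inv_braiding] using
      Chu.isHom_braiding B.obj A.obj)

lemma μ_braiding (A B : SepExtChu D) :
    μ A B ≫ (forget D).map (braiding A B).hom = (β_ A.obj.fst B.obj.fst).hom ≫ μ B A :=
  fac_isoOfQuotient_hom (isQuotient_μ A B) (isQuotient_μ B A) _ _ _

/-- The symmetry whose components are `SepExtChu.braiding`. -/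
abbrev symmetricCategory : SymmetricCategory (SepExtChu D) :=
  (inducingData D).symmetricCategory braiding fun A B => μ_braiding A B

attribute [local instance] symmetricCategory

/-- The forgetful functor to `V` is lax symmetric monoidal, with the canonical maps to the
separation as structure maps. -/
abbrev laxBraided : (forget D).LaxBraided where
  toLaxMonoidal := (inducingData D).laxMonoidal
  braided A B := μ_braiding A B

attribute [local instance] laxBraided

lemma isQuotient_laxMonoidal_μ (A B : SepExtChu D) :
    Chu.IsQuotient (A.obj.tensor B.obj) (A ⊗ B).obj (Functor.LaxMonoidal.μ (forget D) A B) :=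
  isQuotient_μ A B

lemma hom_ext_tensor {A B E : SepExtChu D} {f g : A ⊗ B ⟶ E}
    (h : Functor.LaxMonoidal.μ (forget D) A B ≫ (forget D).map f =
      Functor.LaxMonoidal.μ (forget D) A B ≫ (forget D).map g) : f = g :=
  hom_ext_of_isQuotient (isQuotient_laxMonoidal_μ A B) h

lemma isHom_μ_comp {A B E : SepExtChu D} (f : A ⊗ B ⟶ E) :
    Chu.IsHom (A.obj.tensor B.obj) E.obj
      (Functor.LaxMonoidal.μ (forget D) A B ≫ (forget D).map f) :=
  (isQuotient_laxMonoidal_μ A B).isHom.comp (isHom_forget_map f)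

/-! ### The internal hom -/

/-- The internal hom `e[A, B]`. -/
def ihomObj (A B : SepExtChu D) : SepExtChu D :=
  ⟨(A.obj.internalHom B.obj).extensionalisation,
    Chu.isSeparated_extensionalisation
      (Chu.isExtensional_internalHom_dual A.property.2 B.property.1),
    Chu.isExtensional_extensionalisation _⟩

lemma isHom_uncurry_proj (A B : SepExtChu D) :
    Chu.IsHom (A.obj.tensor (ihomObj A B).obj) B.obj
      (MonoidalClosed.uncurry (A.obj.internalHomProj B.obj)) := by
  have h := ((Chu.isHom_id A.obj).tensor
    (Chu.isHom_extensionalisation_id (A.obj.internalHom B.obj))).comp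
    (Chu.isHom_uncurry_internalHomProj A.obj B.obj)
  rwa [id_tensorHom_id, Category.id_comp] at h

/-- The evaluation, induced by that of `V`. -/
def eval (A B : SepExtChu D) : A ⊗ ihomObj A B ⟶ B :=
  desc (isQuotient_laxMonoidal_μ A (ihomObj A B)) _ (isHom_uncurry_proj A B)

lemma μ_eval (A B : SepExtChu D) :
    Functor.LaxMonoidal.μ (forget D) A (ihomObj A B) ≫ (forget D).map (eval A B) =
      MonoidalClosed.uncurry (A.obj.internalHomProj B.obj) :=
  fac_desc (isQuotient_laxMonoidal_μ A (ihomObj A B)) _ (isHom_uncurry_proj A B)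

lemma μ_whiskerLeft_eval {A B X : SepExtChu D} (k : X ⟶ ihomObj A B) :
    Functor.LaxMonoidal.μ (forget D) A X ≫ (forget D).map (A ◁ k ≫ eval A B) =
      MonoidalClosed.uncurry ((forget D).map k ≫ A.obj.internalHomProj B.obj) := by
  rw [Functor.map_comp, ← Functor.LaxMonoidal.μ_natural_right_assoc, μ_eval]
  exact (MonoidalClosed.uncurry_natural_left _ _).symm

/-- The universal property of the evaluation. Uniqueness holds since `[A, B]₀ ⟶ [A, B]` is a
monomorphism for extensional `A`. -/
lemma bijective_whiskerLeft_eval (A B X : SepExtChu D) :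
    Function.Bijective fun k : X ⟶ ihomObj A B => A ◁ k ≫ eval A B := by
  constructor
  · intro k k' h
    have h' := congr(Functor.LaxMonoidal.μ (forget D) A X ≫ (forget D).map $h)
    rw [μ_whiskerLeft_eval, μ_whiskerLeft_eval] at h'
    have := Chu.mono_internalHomProj A.property.2 B.obj
    exact (forget D).map_injective
      ((cancel_mono (A.obj.internalHomProj B.obj)).1 (MonoidalClosed.uncurry_injective h'))
  · intro h
    obtain ⟨x, hx, hx'⟩ := (isHom_μ_comp h).exists_internalHom_lift
    refine ⟨homMk x (X.property.2.isHom_extensionalisation hx'), hom_ext_tensor ?_⟩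
    dsimp only
    rw [μ_whiskerLeft_eval]
    refine (congrArg MonoidalClosed.uncurry hx).trans (MonoidalClosed.uncurry_curry _)

/-- The tensor-hom adjunction, given from right to left by composition with the evaluation. -/
def homEquiv (A X B : SepExtChu D) : (A ⊗ X ⟶ B) ≃ (X ⟶ ihomObj A B) :=
  (Equiv.ofBijective _ (bijective_whiskerLeft_eval A B X)).symm

lemma homEquiv_symm_apply {A X B : SepExtChu D} (k : X ⟶ ihomObj A B) :
    (homEquiv A X B).symm k = A ◁ k ≫ eval A B := rfl

lemma homEquiv_naturality_left (A : SepExtChu D) (X' X B : SepExtChu D) (f : X' ⟶ X)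
    (g : A ⊗ X ⟶ B) : homEquiv A X' B (A ◁ f ≫ g) = f ≫ homEquiv A X B g := by
  rw [← Equiv.eq_symm_apply, homEquiv_symm_apply, whiskerLeft_comp, Category.assoc,
    ← homEquiv_symm_apply, Equiv.symm_apply_apply]

/-- The closed structure with internal hom `e[A, B]`. -/
abbrev monoidalClosed : MonoidalClosed (SepExtChu D) where
  closed A :=
    { rightAdj := Adjunction.rightAdjointOfEquiv (F := tensorLeft A) (homEquiv A)
        (homEquiv_naturality_left A)
      adj := Adjunction.adjunctionOfEquivRight (F := tensorLeft A) (homEquiv A)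
         (homEquiv_naturality_left A) }

attribute [local instance] monoidalClosed

lemma ihom_ev_app (A B : SepExtChu D) : (ihom.ev A).app B = eval A B := by
  have : (ihom.ev A).app B = (homEquiv A _ B).symm (𝟙 _) := rfl
  rw [this, homEquiv_symm_apply, whiskerLeft_id, Category.id_comp]

/-! ### The dualising object -/

variable (D) in
/-- The dualising object `eD`. -/
def dualizingObj : SepExtChu D :=
  ⟨(Chu.dualizing D).extensionalisation,
    Chu.isSeparated_extensionalisation (Chu.isSeparated_dualizing D),
    Chu.isExtensional_extensionalisation _⟩

lemma isHom_dualizingObj_iff {A B : SepExtChu D} (g : A.obj.fst ⊗ B.obj.fst ⟶ D) :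
    Chu.IsHom (A.obj.tensor B.obj) (dualizingObj D).obj g ↔
      A.obj.IsRep g ∧ B.obj.IsRep ((β_ B.obj.fst A.obj.fst).hom ≫ g) := by
  rw [← Chu.isHom_dualizing_iff]
  refine ⟨fun h => ?_,
    (Chu.isExtensional_tensor A.property.2 B.property.2).isHom_extensionalisation⟩
  have h' : Chu.IsHom (A.obj.tensor B.obj) (Chu.dualizing D) (g ≫ 𝟙 D) :=
    h.comp (Chu.isHom_extensionalisation_id (Chu.dualizing D))
  rwa [Category.comp_id] at h'

/-- The dual `(A', A)` of a separated extensional Chu space `(A, A')`. -/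
def dualObj (A : SepExtChu D) : SepExtChu D :=
  ⟨A.obj.dual, (Chu.isSeparated_dual_iff _).2 A.property.2, A.property.1⟩

/-- The pairing `A ⊗ A^* ⟶ eD` lying over the pairing of the Chu space `A`. -/
def pairing (A : SepExtChu D) : A ⊗ dualObj A ⟶ dualizingObj D :=
  desc (isQuotient_laxMonoidal_μ A (dualObj A)) A.obj.pair
    ((isHom_dualizingObj_iff (B := dualObj A) _).2
      ⟨A.obj.isRep_pair, (dualObj A).obj.isRep_pair⟩)

lemma μ_pairing (A : SepExtChu D) :
    Functor.LaxMonoidal.μ (forget D) A (dualObj A) ≫ (forget D).map (pairing A) = A.obj.pair :=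
  fac_desc (isQuotient_laxMonoidal_μ A (dualObj A)) _ _

lemma μ_whiskerLeft_pairing {A X : SepExtChu D} (k : X ⟶ dualObj A) :
    Functor.LaxMonoidal.μ (forget D) A X ≫ (forget D).map (A ◁ k ≫ pairing A) =
      A.obj.fst ◁ (forget D).map k ≫ A.obj.pair := by
  rw [Functor.map_comp, ← Functor.LaxMonoidal.μ_natural_right_assoc, μ_pairing]
  rfl

/-- The pairing exhibits `A^*` as the internal hom from `A` to the dualising object. -/
lemma bijective_whiskerLeft_pairing (A X : SepExtChu D) :
    Function.Bijective fun k : X ⟶ dualObj A => A ◁ k ≫ pairing A := by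
  constructor
  · intro k k' h
    have h' := congr(Functor.LaxMonoidal.μ (forget D) A X ≫ (forget D).map $h)
    rw [μ_whiskerLeft_pairing, μ_whiskerLeft_pairing] at h'
    exact (forget D).map_injective (A.property.2.hom_ext h')
  · intro h
    obtain ⟨⟨x, hx⟩, hX⟩ := (isHom_dualizingObj_iff _).1 (isHom_μ_comp h)
    refine ⟨homMk (B := dualObj A) x ?_, hom_ext_tensor ?_⟩
    · rw [← hx, ← BraidedCategory.braiding_naturality_left_assoc] at hX
      exact hX
    · dsimp only
      rw [μ_whiskerLeft_pairing]
      exact hx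

/-- The dual of the dual of `A` is `A`. The two differ only by the square of the braiding in the
pairing, so both components are identities. -/
def doubleDualIso (A : SepExtChu D) : A ≅ dualObj (dualObj A) where
  hom := homMk (B := dualObj (dualObj A)) (𝟙 A.obj.fst)
    (by simpa [Chu.IsHom, dualObj] using A.obj.isRep_pair)
  inv := homMk (A := dualObj (dualObj A)) (𝟙 A.obj.fst)
    (by
      have := (dualObj (dualObj A)).obj.isRep_pair
      simpa [Chu.IsHom, dualObj] using this)
  hom_inv_id := (forget D).map_injective (Category.comp_id _)
  inv_hom_id := (forget D).map_injective (Category.comp_id _)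

/-- The pairing of `A` with `A^*` is also that of `A^*` with `A^{**} ≅ A`, so it is universal on
both sides. -/
lemma isDualizing_dualizingObj : IsDualizing (dualizingObj D) := fun A => by
  have h₁ : ∀ B : SepExtChu D, IsIso (MonoidalClosed.curry (pairing B)) := fun B =>
    isIso_curry_of_bijective _ (bijective_whiskerLeft_pairing B)
  -- Up to `A ≅ A^{**}`, the pairing of the dual is the pairing of `A` precomposed with `β`.
  have h₂ : (β_ (dualObj A) A).hom ≫ pairing A =
      dualObj A ◁ (doubleDualIso A).hom ≫ pairing (dualObj A) := by
    apply hom_ext_tensor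
    rw [μ_whiskerLeft_pairing, Functor.map_comp, Functor.LaxBraided.braided_assoc, μ_pairing]
    exact ((congrArg (· ≫ (dualObj A).obj.pair) (MonoidalCategory.whiskerLeft_id _ _)).trans
      (Category.id_comp _)).symm
  have h₃ : IsIso (MonoidalClosed.curry ((β_ (dualObj A) A).hom ≫ pairing A)) := by
    have := h₁ (dualObj A)
    rw [h₂, MonoidalClosed.curry_natural_left]
    infer_instance
  have := h₁ A
  exact isIso_toDoubleDual (pairing A)

/-! ### Free separated extensional Chu spaces -/

variable (D) in
/-- The free separated extensional Chu space `s(X, [X, D], ev)` on `X`. -/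
def freeObj (X : V) : SepExtChu D :=
  ⟨(Chu.free D X).separation, Chu.isSeparated_separation _,
    Chu.isExtensional_separation (Chu.isExtensional_free D X)⟩

variable (D) in
/-- The universal map from `X` to the free separated extensional Chu space on it. -/
def freeUnit (X : V) : X ⟶ (freeObj D X).obj.fst := (Chu.free D X).toSeparation

omit [HasPullbacks V] in
variable (D) in
lemma isQuotient_freeUnit (X : V) :
    Chu.IsQuotient (Chu.free D X) (freeObj D X).obj (freeUnit D X) :=
  Chu.isQuotient_toSeparation _

omit [HasPullbacks V] in
lemma bijective_freeUnit_comp (X : V) (A : SepExtChu D) :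
    Function.Bijective fun f : freeObj D X ⟶ A => freeUnit D X ≫ (forget D).map f :=
  ⟨fun _ _ h => hom_ext_of_isQuotient (isQuotient_freeUnit D X) h,
    fun g => ⟨desc (isQuotient_freeUnit D X) g (Chu.isHom_free g),
      fac_desc (isQuotient_freeUnit D X) g (Chu.isHom_free g)⟩⟩

variable (D) in
/-- The universal property of `freeObj` as a natural bijection. -/
def freeHomEquiv (X : V) (A : SepExtChu D) : (freeObj D X ⟶ A) ≃ (X ⟶ (forget D).obj A) :=
  Equiv.ofBijective _ (bijective_freeUnit_comp X A)

omit [HasPullbacks V] in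
variable (D) in
lemma freeHomEquiv_naturality (X : V) (A A' : SepExtChu D) (g : A ⟶ A') (h : freeObj D X ⟶ A) :
    freeHomEquiv D X A' (h ≫ g) = freeHomEquiv D X A h ≫ (forget D).map g := by
  simp [freeHomEquiv]

variable (D) in
/-- The functor `X ↦ s(X, [X, D], ev)`. -/
def freeFunctor : V ⥤ SepExtChu D :=
  Adjunction.leftAdjointOfEquiv (freeHomEquiv D) (freeHomEquiv_naturality D)

variable (D) in
/-- The free functor is left adjoint to the forgetful functor to `V`. -/
def freeAdjunction : freeFunctor D ⊣ forget D :=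
  Adjunction.adjunctionOfEquivLeft (freeHomEquiv D) (freeHomEquiv_naturality D)

omit [HasPullbacks V] in
lemma freeAdjunction_unit_app (X : V) : (freeAdjunction D).unit.app X = freeUnit D X :=
  (Adjunction.mkOfHomEquiv_unit_app _ _).trans (Category.comp_id _)

/-- The tensor product of two free objects is a separated quotient of `(X, [X, D]) ⊗ (Y, [Y, D])`,
for which, as for `(X ⊗ Y, [X ⊗ Y, D])`, every form is representable. This makes the comparison map
an isomorphism. -/
lemma isQuotient_freeUnit_tensor (X Y : V) :
    Chu.IsQuotient ((Chu.free D X).tensor (Chu.free D Y)) (freeObj D X ⊗ freeObj D Y).obj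
      ((freeUnit D X ⊗ₘ freeUnit D Y) ≫
        Functor.LaxMonoidal.μ (forget D) (freeObj D X) (freeObj D Y)) := by
  rw [MonoidalCategory.tensorHom_def]
  exact (((isQuotient_freeUnit D X).tensorRight (Chu.isExtensional_free D Y)).comp
    ((isQuotient_freeUnit D Y).tensorLeft (freeObj D X).property.2)).comp
    (isQuotient_laxMonoidal_μ _ _)

omit [Coregular V] in
lemma isHom_tensor_free {X Y : V} {A : Chu D} (g : X ⊗ Y ⟶ A.fst) :
    Chu.IsHom ((Chu.free D X).tensor (Chu.free D Y)) A g :=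
  (Chu.isRep_tensor_iff _ _ _).2 ⟨Chu.isRep_free _, Chu.isRep_free _⟩

/-- The oplax monoidal structure on the free functor, the mate of the lax one on the forgetful
functor. -/
abbrev freeOplaxMonoidal : (freeFunctor D).OplaxMonoidal :=
  (freeAdjunction D).leftAdjointOplaxMonoidal

attribute [local instance] freeOplaxMonoidal

lemma freeUnit_δ (X Y : V) :
    freeUnit D (X ⊗ Y) ≫ (forget D).map (Functor.OplaxMonoidal.δ (freeFunctor D) X Y) =
      (freeUnit D X ⊗ₘ freeUnit D Y) ≫
        Functor.LaxMonoidal.μ (forget D) (freeObj D X) (freeObj D Y) := by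
  have := (freeAdjunction D).unit_app_tensor_comp_map_δ X Y
  rw [freeAdjunction_unit_app, freeAdjunction_unit_app, freeAdjunction_unit_app] at this
  exact this

lemma freeUnit_η :
    freeUnit D (𝟙_ V) ≫ (forget D).map (Functor.OplaxMonoidal.η (freeFunctor D)) =
      Functor.LaxMonoidal.ε (forget D) := by
  have := (freeAdjunction D).unit_app_unit_comp_map_η
  rwa [freeAdjunction_unit_app] at this

instance (X Y : V) : IsIso (Functor.OplaxMonoidal.δ (freeFunctor D) X Y) := by
  have h := fac_isoOfQuotient_hom (isQuotient_freeUnit D (X ⊗ Y)) (isQuotient_freeUnit_tensor X Y)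
    (Iso.refl _) (Chu.isHom_free _) (isHom_tensor_free _)
  have : Functor.OplaxMonoidal.δ (freeFunctor D) X Y =
      (isoOfQuotient (isQuotient_freeUnit D (X ⊗ Y)) (isQuotient_freeUnit_tensor X Y)
        (Iso.refl _) (Chu.isHom_free _) (isHom_tensor_free _)).hom :=
    hom_ext_of_isQuotient (isQuotient_freeUnit D (X ⊗ Y))
      ((freeUnit_δ X Y).trans ((Category.id_comp _).symm.trans h.symm))
  rw [this]
  exact Iso.isIso_hom _

instance : IsIso (Functor.OplaxMonoidal.η (freeFunctor D)) := by
  have h := fac_isoOfQuotient_hom (isQuotient_freeUnit D (𝟙_ V)) (isQuotient_ε D)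
    (Iso.refl _) (Chu.isHom_free _) (Chu.isRep_unit _)
  have : Functor.OplaxMonoidal.η (freeFunctor D) =
      (isoOfQuotient (isQuotient_freeUnit D (𝟙_ V)) (isQuotient_ε D)
        (Iso.refl _) (Chu.isHom_free _) (Chu.isRep_unit _)).hom :=
    hom_ext_of_isQuotient (isQuotient_freeUnit D (𝟙_ V))
      (freeUnit_η.trans ((Category.id_comp _).symm.trans h.symm))
  rw [this]
  exact Iso.isIso_hom _

omit [HasPullbacks V] in
lemma freeUnit_naturality {X Y : V} (f : X ⟶ Y) :
    freeUnit D X ≫ (forget D).map ((freeFunctor D).map f) = f ≫ freeUnit D Y := by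
  rw [← freeAdjunction_unit_app, ← freeAdjunction_unit_app]
  exact ((freeAdjunction D).unit.naturality f).symm

lemma δ_braiding (X Y : V) :
    (freeFunctor D).map (β_ X Y).hom ≫ Functor.OplaxMonoidal.δ (freeFunctor D) Y X =
      Functor.OplaxMonoidal.δ (freeFunctor D) X Y ≫
        (β_ ((freeFunctor D).obj X) ((freeFunctor D).obj Y)).hom := by
  refine hom_ext_of_isQuotient (isQuotient_freeUnit D (X ⊗ Y)) ?_
  have h : (freeUnit D (X ⊗ Y) ≫ (forget D).map ((freeFunctor D).map (β_ X Y).hom)) ≫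
        (forget D).map (Functor.OplaxMonoidal.δ (freeFunctor D) Y X) =
      (freeUnit D (X ⊗ Y) ≫ (forget D).map (Functor.OplaxMonoidal.δ (freeFunctor D) X Y)) ≫
        (forget D).map (β_ (freeObj D X) (freeObj D Y)).hom := by
    rw [freeUnit_naturality, freeUnit_δ]
    refine ((Category.assoc _ _ _).trans
      (congrArg ((β_ X Y).hom ≫ ·) (freeUnit_δ Y X))).trans ?_
    have h' : (freeUnit D X ⊗ₘ freeUnit D Y) ≫
          Functor.LaxMonoidal.μ (forget D) (freeObj D X) (freeObj D Y) ≫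
          (forget D).map (β_ (freeObj D X) (freeObj D Y)).hom =
        (β_ X Y).hom ≫ (freeUnit D Y ⊗ₘ freeUnit D X) ≫
          Functor.LaxMonoidal.μ (forget D) (freeObj D Y) (freeObj D X) := by
      rw [Functor.LaxBraided.braided]
      exact BraidedCategory.braiding_naturality_assoc _ _ _
    exact h'.symm.trans (Category.assoc _ _ _).symm
  exact (Category.assoc _ _ _).symm.trans (h.trans (Category.assoc _ _ _))

/-- The oplax structure maps of the free functor are isomorphisms, so it is strong monoidal. -/
abbrev freeMonoidal : (freeFunctor D).Monoidal := .ofOplaxMonoidal _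

/-- The free functor is strong symmetric monoidal. -/
abbrev freeBraided : (freeFunctor D).Braided where
  toMonoidal := freeMonoidal
  braided X Y := by
    have h (X Y : V) : Functor.OplaxMonoidal.δ (freeFunctor D) X Y ≫
        freeMonoidal.toLaxMonoidal.μ X Y = 𝟙 _ :=
      freeMonoidal.δ_μ X Y
    rw [← cancel_epi (Functor.OplaxMonoidal.δ (freeFunctor D) X Y), reassoc_of% h X Y,
      ← reassoc_of% δ_braiding X Y, h Y X, Category.comp_id]

/-- All comparison isomorphisms with the prescribed separations and extensionalisations are
identities. -/
lemma isSepExtChuStructure : IsSepExtChuStructure D (dualizingObj D) where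
  tensor A B := ⟨Iso.refl _, Category.comp_id _⟩
  unit := ⟨Iso.refl _, Category.comp_id _⟩
  internalHom A B := ⟨Iso.refl _, by
    rw [ihom_ev_app]
    erw [μ_eval]
    exact (Category.id_comp _).trans (MonoidalClosed.curry_uncurry _).symm⟩
  dualizing := rfl

end Monoidal

end SepExtChu

end

theorem mainTheorem2
    {C : Type u₁} [Category.{v₁} C] [CartesianMonoidalCategory C] [BraidedCategory C]
    [MonoidalClosed C] [HasLimits C] [HasColimits C] [Coregular C]
    {V : Type u₂} [Category.{v₂} V] [MonoidalCategory V] [SymmetricCategory V]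
    [MonoidalClosed V] [HasLimits V] [HasColimits V] [Coregular V]
    (T : C ⥤ V) (G : V ⥤ C) (adj : T ⊣ G) [T.Braided] (D : V) :
    ∃ (_ : MonoidalCategory (SepExtChu D)) (_ : SymmetricCategory (SepExtChu D))
      (_ : MonoidalClosed (SepExtChu D)) (_ : (SepExtChu.forget D).LaxBraided)
      (E : SepExtChu D),
      IsSepExtChuStructure D E ∧ IsDualizing E ∧
      ∃ (M : C ⥤ SepExtChu D) (_ : M.Braided), Nonempty (M ⊣ SepExtChu.forget D ⋙ G) := by
  let _ := SepExtChu.monoidalCategory (D := D)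
  let _ := SepExtChu.symmetricCategory (D := D)
  let _ := SepExtChu.freeBraided (D := D)
  exact ⟨SepExtChu.monoidalCategory, SepExtChu.symmetricCategory, SepExtChu.monoidalClosed,
    SepExtChu.laxBraided, SepExtChu.dualizingObj D, SepExtChu.isSepExtChuStructure,
    SepExtChu.isDualizing_dualizingObj, T ⋙ SepExtChu.freeFunctor D, inferInstance,
    ⟨adj.comp (SepExtChu.freeAdjunction D)⟩⟩
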